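/- Let $\mathfrak t$ be a subspace of dimension $l$ of a finite-dimensional real inner product space $\mathfrak k$ of dimension $s_0$ (in the application: the Lie algebras of a maximal torus and of a compact Lie group). Let $[d\psi]$ be Lebesgue measure on $\mathfrak t$ given by the inner product, $\psi_1,\dots,\psi_l$ orthonormal coordinates on $\mathfrak t$, and $\lambda_1,\dots,\lambda_l$ the dual coordinates on $\mathfrak t^*$; for a multi-index $J\in\mathbb N^l$ put $\psi^J=\prod_k\psi_k^{J_k}$ and $|J|=\sum_k J_k$. Functionals in $\mathfrak t^*$ are extended complex-linearly to $\mathfrak t\otimes\mathbb C$. **Residue.** Let $\Lambda\subset\mathfrak t$ be a convex cone with nonempty interior. Let $\chi:\mathfrak k^*\to\mathbb R$ be smooth with compact support, with Fourier transform $\hat\chi(\phi)=(2\pi)^{-s_0/2}\int_{\mathfrak k^*}\chi(z)e^{-iz(\phi)}\,dz$ (an entire function on $\mathfrak k\otimes\mathbb C$), normalized by $\hat\chi(0)=1$. For a function $h$ on $\mathfrak t\otimes\mathbb C$, $$\operatorname{Res}(h\,[d\psi])=\lim_{\epsilon\to0^+}\frac1{(2\pi i)^l}\int_{\psi\in\mathfrak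 t-i\xi}\hat\chi(\epsilon\psi)\,h(\psi)\,[d\psi],$$ where $\xi$ is any point of the interior of $\Lambda$; we say that the residue exists if, for every such $\xi$, these integrals converge absolutely for all $\epsilon>0$ and the limit exists and does not depend on $\xi$. **Setting.** Let $\beta_1,\dots,\beta_N\in\mathfrak t^*$ be nonzero elements of the dual cone of $\Lambda$, that is $\beta_j(x)\ge0$ for all $x\in\Lambda$. Let $P=\prod_j\beta_j$ and $\Omega_\lambda=e^{i\lambda(\psi)}[d\psi]/P(\psi)$. Let $C_{\bar\beta}=\{\sum_j s_j\beta_j: s_j\ge0\}$, and let $U_{\bar\beta}\subset\mathfrak t^*$ be the set of points which lie in no cone spanned by fewer than $l$ of the $\beta_j$. Let $H_{\bar\beta}(\lambda)=\operatorname{vol}\{(s_1,\dots,s_N): s_j\ge0,\ \lambda=\sum_j s_j\beta_j\}$, normalized as the density, with respect to Lebesgue measure on $\mathfrak t^*$, of the push-forward of Lebesgue measure on $\{s\in\mathbb R^N: s_j\ge 0\}$ under $s\mapsto\sum_j s_j\beta_j$; precisely $$H_{\bar\beta}(\lambda)=\lim_{r\to0^+}\frac{\operatorname{vol}\{s\ge0:\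 |\sum_j s_j\beta_j-\lambda|<r\}}{\operatorname{vol}\{x\in\mathfrak t^*:\ |x-\lambda|<r\}}.$$ **Proposition.** For all $J$ and all $\lambda\in U_{\bar\beta}$ the residue $\operatorname{Res}(\psi^J\Omega_\lambda)$ exists and, for every $\rho\in\mathfrak t^*$, equals $\lim_{t\to0^+}\operatorname{Res}(\psi^J\Omega_{\lambda+t\rho})$. Moreover, for all $J$ and all $\lambda\in U_{\bar\beta}$: 1. (i) for each $k$ the partial derivative $\partial/\partial\lambda_k$ of $\operatorname{Res}(\psi^J\Omega_\lambda)$ exists, and $\operatorname{Res}(\psi_k\psi^J\Omega_\lambda)=-i\,\frac{\partial}{\partial\lambda_k}\operatorname{Res}(\psi^J\Omega_\lambda)$; 2. (ii) the limit defining $H_{\bar\beta}(\lambda)$ exists, and $(2\pi i)^l\operatorname{Res}(\Omega_\lambda)=(2\pi)^l\,i^N H_{\bar\beta}(\lambda)$; 3. (iii) $\operatorname{Res}(\Omega_\lambda)=0$ unless $\lambda\in C_{\bar\beta}$; 4. (iv) $\lim_{s\to0^+}\operatorname{Res}(\psi^J\Omega_{s\lambda})=0$ unless $N-|J|=l$;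 5. (v) $\lim_{s\to0^+}\operatorname{Res}(\psi^J\Omega_{s\lambda})=0$ if the $\beta_j$ do not span $\mathfrak t^*$; 6. (vi) if $l$ of the weights, say $\beta_1,\dots,\beta_l$, span $\mathfrak t^*$ and $\mu=\sum_{j=1}^l\mu^j\beta_j$ with all $\mu^j>0$ (here $\mu$ need not lie in $U_{\bar\beta}$), then $$\lim_{s\to0^+}\operatorname{Res}\Bigl(\frac{e^{is\mu(\psi)}[d\psi]}{\beta_1(\psi)\cdots\beta_l(\psi)}\Bigr)=\frac1{|\det\bar\beta|},$$ where $\det\bar\beta$ is the determinant of the $l\times l$ matrix whose columns are the coordinates of $\beta_1,\dots,\beta_l$ in any orthonormal basis; 7. (vii) for every $m\ge 0$ the residues on the right-hand side below exist for all $s>0$ and their limit as $s\to0^+$ exists, the series converges, and $$\operatorname{Res}\Bigl(\frac{e^{i\lambda(\psi)}\psi^J}{P(\psi)}[d\psi]\Bigr)=\sum_{m\ge0}\lim_{s\to0^+}\operatorname{Res}\Bigl(\frac{(i\lambda(\psi))^m e^{is\lambda(\psi)}\psi^J}{m!\,P(\psi)}[d\psi]\Bigr).$$ Finally, (i) and (ii)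 characterize the residues: if functions $R_J$ ($J\in\mathbb N^l$) on $\mathfrak t^*$ satisfy, on $U_{\bar\beta}$, the equations $(2\pi i)^l R_0(\lambda)=(2\pi)^l i^N H_{\bar\beta}(\lambda)$ and $R_{J+e_k}(\lambda)=-i\,\partial R_J/\partial\lambda_k(\lambda)$ for all $J$ and $k$ (a partial derivative that does not exist being read as $0$), then $R_J(\lambda)=\operatorname{Res}(\psi^J\Omega_\lambda)$ for all $J$ and all $\lambda\in U_{\bar\beta}$. -/

import Mathlib

open MeasureTheory Filter Topology
open scoped ContDiff Real

namespace JKResidue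

noncomputable section

/-- The real vector space `𝔱` of dimension `l`, in orthonormal coordinates.  Its dual `𝔱*` is
identified with it by the inner product, so elements of `𝔱*` are coordinate vectors as well.
`volume` is the Lebesgue measure `[dψ]` of the inner product. -/
abbrev T (l : ℕ) := EuclideanSpace ℝ (Fin l)

/-- The ambient space `𝔨 = 𝔱 ⊕ 𝔱^⊥` (identified with `𝔨*` by the inner product), in adapted
orthonormal coordinates: the coordinates in `Fin l` are those of `𝔱`. -/
abbrev Amb (l n : ℕ) := EuclideanSpace ℝ (Fin l ⊕ Fin n)

/-- The complex-linear extension to `𝔱 ⊗ ℂ` of a linear functional `y ∈ 𝔱*`: `ζ ↦ y(ζ)`. -/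
def pair {l : ℕ} (y : T l) (ζ : Fin l → ℂ) : ℂ := ∑ k, (y k : ℂ) * ζ k

/-- The point `ψ - i ξ` of `𝔱 ⊗ ℂ`. -/
def shift {l : ℕ} (ψ ξ : T l) : Fin l → ℂ := fun k => (ψ k : ℂ) - Complex.I * (ξ k : ℂ)

/-- The Fourier transform `χ̂(ζ) = (2π)^{-s/2} ∫_{𝔨*} χ(z) e^{-i z(ζ)} dz`, where `s = dim 𝔨 = l + n`,
of a function `χ` on `𝔨*`, evaluated at `ζ ∈ 𝔱 ⊗ ℂ ⊆ 𝔨 ⊗ ℂ`. -/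
def fourierAt {l n : ℕ} (χ : Amb l n → ℝ) (ζ : Fin l → ℂ) : ℂ :=
  (((2 * π) ^ (-(((l + n : ℕ) : ℝ) / 2)) : ℝ) : ℂ) *
    ∫ z : Amb l n, (χ z : ℂ) * Complex.exp (-Complex.I * ∑ k, (z (Sum.inl k) : ℂ) * ζ k)

/-- A test function `χ : 𝔨* → ℝ`: smooth, compactly supported, with `χ̂(0) = 1`.  Neither
positivity near `0` nor invariance under a group is required. -/
structure IsTestFunction {l n : ℕ} (χ : Amb l n → ℝ) : Prop where
  smooth : ContDiff ℝ ∞ χ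
  compact : HasCompactSupport χ
  normalized : fourierAt χ 0 = 1

/-- The integrand `χ̂(ε ζ) h(ζ)` at `ζ = ψ - i ξ`. -/
def regIntegrand {l n : ℕ} (χ : Amb l n → ℝ) (h : (Fin l → ℂ) → ℂ) (ξ : T l) (ε : ℝ)
    (ψ : T l) : ℂ :=
  fourierAt χ ((ε : ℂ) • shift ψ ξ) * h (shift ψ ξ)

/-- `HasResidue Λ χ h r` says that
`lim_{ε → 0+} (2πi)^{-l} ∫_{𝔱 - iξ} χ̂(ε ψ) h(ψ) [dψ] = r` for every `ξ` in the interior of the cone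
`Λ`, all these integrals being absolutely convergent; that is, `Res (h [dψ])` exists (and does not
depend on `ξ`) and is `r`. -/
def HasResidue {l n : ℕ} (Λ : ConvexCone ℝ (T l)) (χ : Amb l n → ℝ) (h : (Fin l → ℂ) → ℂ)
    (r : ℂ) : Prop :=
  ∀ ξ ∈ interior (Λ : Set (T l)),
    (∀ ε : ℝ, 0 < ε → Integrable (regIntegrand χ h ξ ε)) ∧
    Tendsto (fun ε : ℝ => 1 / (2 * (π : ℂ) * Complex.I) ^ l * ∫ ψ : T l, regIntegrand χ h ξ ε ψ)
      (𝓝[>] 0) (𝓝 r)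

/-- The residue `Res (h [dψ])`, meaningful when some `r` satisfies `HasResidue Λ χ h r`. -/
def res {l n : ℕ} (Λ : ConvexCone ℝ (T l)) (χ : Amb l n → ℝ) (h : (Fin l → ℂ) → ℂ) : ℂ :=
  Classical.epsilon (HasResidue Λ χ h)

/-- The coefficient of `[dψ]` in `g(ψ) Ω_y(ψ)`, that is `g(ψ) e^{i y(ψ)} / ∏_j β_j(ψ)`, as a function
on `𝔱 ⊗ ℂ`. -/
def form {l N : ℕ} (g : (Fin l → ℂ) → ℂ) (β : Fin N → T l) (y : T l) (ζ : Fin l → ℂ) : ℂ :=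
  g ζ * Complex.exp (Complex.I * pair y ζ) / ∏ j, pair (β j) ζ

/-- The monomial `ψ^J`. -/
def mono {l : ℕ} (J : Fin l → ℕ) (ζ : Fin l → ℂ) : ℂ := ∏ k, ζ k ^ J k

/-- The cone spanned by the `β_j` with `j ∈ S`. -/
def cone {l N : ℕ} (β : Fin N → T l) (S : Finset (Fin N)) : Set (T l) :=
  {y | ∃ c : Fin N → ℝ, (∀ j, 0 ≤ c j) ∧ y = ∑ j ∈ S, c j • β j}

/-- The set `U_β` of the points which lie in no cone spanned by fewer than `l` of the `β_j`. -/
def genericSet {l N : ℕ} (β : Fin N → T l) : Set (T l) :=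
  {y | ∀ S : Finset (Fin N), S.card < l → y ∉ cone β S}

/-- The distribution `H_{β_1} * ⋯ * H_{β_N}`: the push-forward of Lebesgue measure on the orthant
`{s ∈ ℝ^N : s_j ≥ 0}` under `s ↦ ∑_j s_j β_j`. -/
def coneMeasure {l N : ℕ} (β : Fin N → T l) : Measure (T l) :=
  Measure.map (fun s : Fin N → ℝ => ∑ j, s j • β j) (volume.restrict {s | ∀ j, 0 ≤ s j})

/-- The ratio `vol {s ≥ 0 : |∑_j s_j β_j - y| < r} / vol {x ∈ 𝔱* : |x - y| < r}`. -/
def volRatio {l N : ℕ} (β : Fin N → T l) (y : T l) (r : ℝ) : ℝ :=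
  (coneMeasure β).real (Metric.ball y r) / (volume : Measure (T l)).real (Metric.ball y r)

/-- `H_β(y) = vol {s : s_j ≥ 0, y = ∑_j s_j β_j}`, the volume of the fibre normalized so that `H_β`
is the density of `coneMeasure β` with respect to Lebesgue measure. -/
def H {l N : ℕ} (β : Fin N → T l) (y : T l) : ℝ := limUnder (𝓝[>] (0 : ℝ)) (volRatio β y)

end

end JKResidue

namespace JKResidue

/-! On the contour `ψ - iξ` with `ξ` interior to `Λ` every `β_j(ξ)` is positive, so `1/β_j(ζ) = i
∫_0^∞ e^{-isβ_j(ζ)} ds`. Restricted to `𝔱 ⊗ ℂ`, the factor `χ̂(εζ)` is the transform of a smooth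
compactly supported mollifier of mass 1 at scale `ε`, and multiplying it by `ζ^J` applies `(-i∂)^J`
to the mollifier. Fubini and Fourier inversion (`integral_laplace_div`) turn the regularized
integral into `i^N (2π)^l` times the convolution of this kernel with `coneMeasure β` at `z`; the
point `ξ` has disappeared.

What remains is that around each generic point `coneMeasure β` has, on an open cone, a polynomial
density `p` that is zero or homogeneous of degree `N - l` (`exists_hasPolynomialDensity`). This
follows by induction on `N` from the truncated-power recursion `(N - l) H_β(x) = ∑_j c_j(x) H_{β
without β_j}(x)`, where `x = ∑_j c_j(x) β_j` with `c` linear (`integral_orthant_recursion`). The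
recursion is used only after integration against test functions, so no regularity of `H` across the
walls is needed.

Moving the derivatives from the kernel to `p` and letting `ε → 0` (`HasSymbol.hasResidue`), the
residue of `ψ^J Ω_z` is `κ ((-i∂)^J p)(z)` with `κ = i^N (2π)^l / (2πi)^l`. Everything is then a
fact about polynomials: (i) is differentiation, (ii) is averaging over small balls, (iii) and (v)
hold because `p = 0` off the cone, (iv) because a homogeneous polynomial of nonzero degree vanishes
at `0`, (vi) because `p` is the constant `1/|det|`, and (vii) is Taylor's formula at `0`. -/

/-! ### Convex geometry of the cones spanned by the weights. -/

/-- In an orthant, the preimage of a bounded set under `s ↦ ∑ j, s j • β j` is bounded, provided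
the `β j` lie in an open half-space. -/
theorem exists_bound_of_isCompact {l N : ℕ} {β : Fin N → T l} {ξ : T l}
    (hξ : ∀ j, 0 < inner ℝ (β j) ξ) {K : Set (T l)} (hK : IsCompact K) :
    ∃ R : ℝ, ∀ s : Fin N → ℝ, (∀ j, 0 ≤ s j) → ∑ j, s j • β j ∈ K → ∀ j, s j ≤ R := by
  obtain ⟨C, hC⟩ := (hK.image (f := fun x => inner ℝ x ξ) (by fun_prop)).bddAbove
  refine ⟨∑ j, |C| / inner ℝ (β j) ξ, fun s hs hsK j => ?_⟩
  have h1 : ∑ i, s i * inner ℝ (β i) ξ ≤ C := by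
    have := hC ⟨_, hsK, rfl⟩
    simpa [sum_inner, inner_smul_left] using this
  have h2 : s j * inner ℝ (β j) ξ ≤ |C| :=
    (Finset.single_le_sum (f := fun i => s i * inner ℝ (β i) ξ)
      (fun i _ => mul_nonneg (hs i) (hξ i).le) (Finset.mem_univ j)).trans
      (h1.trans (le_abs_self C))
  exact ((le_div_iff₀ (hξ j)).2 h2).trans
    (Finset.single_le_sum (f := fun i => |C| / inner ℝ (β i) ξ)
      (fun i _ => div_nonneg (abs_nonneg C) (hξ i).le) (Finset.mem_univ j))

/-- The parametrization is proper on the orthant, so near any point the cone is contained in the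
image of a compact box. -/
theorem isClosed_cone {l N : ℕ} {β : Fin N → T l} {ξ : T l}
    (hξ : ∀ j, 0 < inner ℝ (β j) ξ) (S : Finset (Fin N)) : IsClosed (cone β S) := by
  refine isClosed_of_closure_subset fun y hy => ?_
  obtain ⟨R, hR⟩ := exists_bound_of_isCompact hξ (isCompact_closedBall y 1)
  have hB : Continuous fun s : Fin N → ℝ => ∑ j ∈ S, s j • β j := by fun_prop
  have hcl := ((isCompact_Icc (a := (0 : Fin N → ℝ)) (b := fun _ => R)).image hB).isClosed
  have hsub : cone β S ∩ Metric.ball y 1 ⊆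
      (fun s : Fin N → ℝ => ∑ j ∈ S, s j • β j) '' Set.Icc 0 (fun _ => R) := by
    rintro x ⟨⟨s, hs, rfl⟩, hx⟩
    have h0 : ∀ j, 0 ≤ if j ∈ S then s j else 0 := fun j => by
      split_ifs
      exacts [hs j, le_rfl]
    -- Coefficients outside `S` do not affect the point; setting them to zero makes the bound for
    -- the full sum applicable.
    refine ⟨fun j => if j ∈ S then s j else 0, ⟨h0, hR _ h0 ?_⟩, by simp [ite_smul]⟩
    simpa [ite_smul] using Metric.ball_subset_closedBall hx
  have hmem : y ∈ closure (cone β S ∩ Metric.ball y 1) :=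
    mem_closure_iff_nhds.2 fun t ht => by
      have := mem_closure_iff_nhds.1 hy (t ∩ Metric.ball y 1)
        (Filter.inter_mem ht (Metric.ball_mem_nhds y one_pos))
      obtain ⟨x, ⟨h1, h2⟩, h3⟩ := this
      exact ⟨x, h1, h3, h2⟩
  obtain ⟨s, hs, rfl⟩ := hcl.closure_subset_iff.2 hsub hmem
  exact ⟨s, hs.1, rfl⟩

/-- Only finitely many closed cones are removed. Openness is what lets functions that agree on the
generic set have equal partial derivatives there. -/
theorem isOpen_genericSet {l N : ℕ} {β : Fin N → T l} {ξ : T l}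
    (hξ : ∀ j, 0 < inner ℝ (β j) ξ) : IsOpen (genericSet β) := by
  have : genericSet β = ⋂ S : {S : Finset (Fin N) // S.card < l}, (cone β S.1)ᶜ := by
    ext y
    simp [genericSet]
  rw [this]
  exact isOpen_iInter_of_finite fun S => (isClosed_cone hξ S.1).isOpen_compl

theorem smul_mem_cone {l N : ℕ} {β : Fin N → T l} {S : Finset (Fin N)} {x : T l} {t : ℝ}
    (ht : 0 ≤ t) (hx : x ∈ cone β S) : t • x ∈ cone β S := by
  obtain ⟨c, hc, rfl⟩ := hx
  exact ⟨t • c, fun j => mul_nonneg ht (hc j), by simp [Finset.smul_sum, smul_smul]⟩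

/-- Conic Carathéodory: a member of a cone spanned by linearly dependent vectors lies in a cone
spanned by fewer of them. -/
theorem exists_erase_mem_cone {l N : ℕ} {β : Fin N → T l} {S : Finset (Fin N)} {y : T l}
    (hy : y ∈ cone β S) (hS : ¬ LinearIndepOn ℝ β (S : Set (Fin N))) :
    ∃ i ∈ S, y ∈ cone β (S.erase i) := by
  obtain ⟨c, hc, rfl⟩ := hy
  rw [linearIndepOn_finset_iff] at hS
  push Not at hS
  obtain ⟨g₀, hg₀, i₀, hi₀, hne⟩ := hS
  obtain ⟨g, hg, hpos⟩ : ∃ g : Fin N → ℝ, ∑ i ∈ S, g i • β i = 0 ∧ ∃ i ∈ S, 0 < g i := by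
    rcases lt_or_gt_of_ne hne with h | h
    · exact ⟨-g₀, by simp [hg₀], i₀, hi₀, by simpa using h⟩
    · exact ⟨g₀, hg₀, i₀, hi₀, h⟩
  obtain ⟨i₁, hi₁, hgi₁⟩ := hpos
  -- The minimal ratio `c i / g i` is the largest multiple of the relation that can be subtracted
  -- while all coefficients stay nonnegative; the coefficient at `i` then vanishes.
  obtain ⟨i, hi, hmin⟩ := (S.filter fun i => 0 < g i).exists_min_image (fun i => c i / g i)
    ⟨i₁, by simp [hi₁, hgi₁]⟩
  rw [Finset.mem_filter] at hi
  have hq : 0 ≤ c i / g i := div_nonneg (hc i) hi.2.le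
  refine ⟨i, hi.1, fun j => if j ∈ S then c j - c i / g i * g j else 0, fun j => ?_, ?_⟩
  · dsimp only
    split_ifs with hj
    · rcases le_or_gt (g j) 0 with h | h
      · have := mul_nonpos_of_nonneg_of_nonpos hq h
        linarith [hc j]
      · have := hmin j (by simp [hj, h])
        rw [le_div_iff₀ h] at this
        linarith
    · exact le_rfl
  · have h1 : ∑ j ∈ S, c j • β j =
        ∑ j ∈ S, (if j ∈ S then c j - c i / g i * g j else 0) • β j := by
      calc ∑ j ∈ S, c j • β j = ∑ j ∈ S, c j • β j - (c i / g i) • ∑ j ∈ S, g j • β j := by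
            simp [hg]
        _ = ∑ j ∈ S, (c j - c i / g i * g j) • β j := by
            simp [Finset.smul_sum, sub_smul, smul_smul]
        _ = _ := Finset.sum_congr rfl fun j hj => by simp [hj]
    rw [h1, ← Finset.add_sum_erase S _ hi.1]
    simp [hi.1, div_mul_cancel₀ _ hi.2.ne']

/-- A smallest set of weights whose cone contains `y` is independent by Carathéodory, and genericity
forces it to have at least `l` members. -/
theorem span_eq_top_of_mem_cone {l N : ℕ} {β : Fin N → T l} {y : T l} (hy : y ∈ genericSet β)
    (hc : y ∈ cone β Finset.univ) : Submodule.span ℝ (Set.range β) = ⊤ := by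
  classical
  obtain ⟨S, hS, hmin⟩ :=
    (Finset.univ.filter fun S : Finset (Fin N) => y ∈ cone β S).exists_min_image Finset.card ⟨Finset.univ, by simp [hc]⟩
  simp only [Finset.mem_filter, Finset.mem_univ, true_and] at hS hmin
  have hind : LinearIndepOn ℝ β (S : Set (Fin N)) := by
    by_contra h
    obtain ⟨i, hi, hiy⟩ := exists_erase_mem_cone hS h
    have := hmin _ hiy
    rw [Finset.card_erase_of_mem hi] at this
    have := Finset.card_pos.2 ⟨i, hi⟩
    omega
  have hcard : l ≤ S.card := not_lt.1 fun h => hy S h hS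
  apply Submodule.eq_top_of_finrank_eq
  refine le_antisymm (Submodule.finrank_le _) ?_
  have h1 : Module.finrank ℝ (Submodule.span ℝ (Set.range fun i : S => β i)) = S.card := by
    exact (finrank_span_eq_card (b := fun i : S => β i) hind).trans (by simp)
  have h2 : Submodule.span ℝ (Set.range fun i : S => β i) ≤ Submodule.span ℝ (Set.range β) :=
    Submodule.span_mono (by rintro _ ⟨i, rfl⟩; exact ⟨i, rfl⟩)
  have := Submodule.finrank_mono h2
  simp only [finrank_euclideanSpace, Fintype.card_fin]
  omega

theorem mem_genericSet_succAbove {l m : ℕ} {β : Fin (m + 1) → T l} {y : T l}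
    (hy : y ∈ genericSet β) (j : Fin (m + 1)) : y ∈ genericSet fun i => β (j.succAbove i) := by
  rintro S hS ⟨c, hc, rfl⟩
  refine hy (S.map j.succAboveEmb) (by simpa using hS)
    ⟨fun i => j.insertNth (α := fun _ => ℝ) 0 c i, fun i => ?_, by simp⟩
  refine Fin.succAboveCases j ?_ (fun i => ?_) i <;> simp [hc]

/-! ### Integration over the orthant and the recursion for truncated powers. -/

theorem integrableOn_orthant {N : ℕ} {E : Type*} [NormedAddCommGroup E] {f : (Fin N → ℝ) → E}
    (hf : Continuous f) {R : ℝ} (hR : ∀ s, (∀ j, 0 ≤ s j) → f s ≠ 0 → ∀ j, s j ≤ R) :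
    IntegrableOn f {s | ∀ j, 0 ≤ s j} := by
  have h0 : MeasurableSet {s : Fin N → ℝ | ∀ j, 0 ≤ s j} := by measurability
  refine IntegrableOn.of_forall_sdiff_eq_zero
    (hf.continuousOn.integrableOn_compact (isCompact_Icc (a := 0) (b := fun _ => R))) h0 ?_
  rintro s ⟨hs, hn⟩
  by_contra h
  exact hn ⟨hs, hR s hs h⟩

theorem integral_orthant_succAbove {m : ℕ} {f : (Fin (m + 1) → ℝ) → ℂ} (j : Fin (m + 1))
    (hf : IntegrableOn f {s | ∀ j, 0 ≤ s j}) :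
    ∫ s in {s : Fin (m + 1) → ℝ | ∀ j, 0 ≤ s j}, f s =
      ∫ s in {s : Fin m → ℝ | ∀ j, 0 ≤ s j}, ∫ t in Set.Ioi (0 : ℝ),
        f (j.insertNth (α := fun _ => ℝ) t s) := by
  set e := (MeasurableEquiv.piFinSuccAbove (fun _ : Fin (m + 1) => ℝ) j).symm 
  have hem : MeasurePreserving e :=
    (volume_preserving_piFinSuccAbove (fun _ : Fin (m + 1) => ℝ) j).symm _
  have hpre : e ⁻¹' {s | ∀ j, 0 ≤ s j} = Set.Ici (0 : ℝ) ×ˢ {s : Fin m → ℝ | ∀ j, 0 ≤ s j} := by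
    ext ⟨t, s⟩
    have : e (t, s) = j.insertNth (α := fun _ => ℝ) t s := rfl
    simp only [Set.mem_preimage, Set.mem_ofPred_eq, Set.mem_prod, Set.mem_Ici, this]
    rw [j.forall_iff_succAbove]
    simp
  rw [← hem.setIntegral_preimage_emb e.measurableEmbedding, hpre, Measure.volume_eq_prod]
  have hint : IntegrableOn (fun z => f (e z)) (Set.Ici (0 : ℝ) ×ˢ {s : Fin m → ℝ | ∀ j, 0 ≤ s j})
      (volume.prod volume) := by
    rw [← hpre]
    exact (hem.integrableOn_comp_preimage e.measurableEmbedding).2 hf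
  rw [← setIntegral_prod_swap, setIntegral_prod]
  · refine integral_congr_ae (.of_forall fun s => ?_)
    exact integral_Ici_eq_integral_Ioi (f := fun t => f (j.insertNth (α := fun _ => ℝ) t s))
  · exact hint.swap

/-- The fundamental theorem of calculus on an orthant. -/
theorem integral_orthant_deriv {m : ℕ} {f f' : (Fin (m + 1) → ℝ) → ℂ} (j : Fin (m + 1))
    (hf' : Continuous f') (hd : ∀ s, HasDerivAt (fun t => f (Function.update s j t)) (f' s) (s j))
    {R : ℝ} (hR : ∀ s, (∀ j, 0 ≤ s j) → f s ≠ 0 → ∀ j, s j ≤ R)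
    (hR' : ∀ s, (∀ j, 0 ≤ s j) → f' s ≠ 0 → ∀ j, s j ≤ R) :
    ∫ s in {s : Fin (m + 1) → ℝ | ∀ j, 0 ≤ s j}, f' s =
      -∫ s in {s : Fin m → ℝ | ∀ j, 0 ≤ s j}, f (j.insertNth (α := fun _ => ℝ) 0 s) := by
  rw [integral_orthant_succAbove j (integrableOn_orthant hf' hR'), ← integral_neg]
  refine setIntegral_congr_fun (by measurability) fun s hs => ?_
  have hnn : ∀ t : ℝ, 0 ≤ t → ∀ i, 0 ≤ j.insertNth (α := fun _ => ℝ) t s i := fun t ht => by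
    rw [j.forall_iff_succAbove]
    simpa using ⟨ht, hs⟩
  have hder : ∀ t ∈ Set.Ici (0 : ℝ), HasDerivAt (fun t => f (j.insertNth (α := fun _ => ℝ) t s))
      (f' (j.insertNth (α := fun _ => ℝ) t s)) t := fun t _ => by
    simpa using hd (j.insertNth (α := fun _ => ℝ) t s)
  have hcont : Continuous fun t : ℝ => f' (j.insertNth (α := fun _ => ℝ) t s) :=
    hf'.comp (by
      refine continuous_pi fun i => ?_
      refine Fin.succAboveCases j ?_ (fun i => ?_) i
      · simpa using continuous_id'
      · simpa using continuous_const)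
  have hint : IntegrableOn (fun t : ℝ => f' (j.insertNth (α := fun _ => ℝ) t s)) (Set.Ioi 0) := by
    refine IntegrableOn.of_forall_sdiff_eq_zero
      (hcont.continuousOn.integrableOn_compact (isCompact_Icc (a := 0) (b := R)))
      measurableSet_Ioi ?_
    rintro t ⟨ht, hn⟩
    by_contra h
    exact hn ⟨ht.le, by simpa using hR' _ (hnn t ht.le) h j⟩
  have hlim : Tendsto (fun t => f (j.insertNth (α := fun _ => ℝ) t s)) atTop (𝓝 0) := by
    refine tendsto_const_nhds.congr' ?_
    filter_upwards [eventually_gt_atTop (max R 0)] with t ht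
    by_contra h
    have := hR _ (hnn t ((le_max_right _ _).trans ht.le)) (Ne.symm h) j
    simp only [Fin.insertNth_apply_same] at this
    linarith [le_max_left R 0]
  simpa using integral_Ioi_of_hasDerivAt_of_tendsto' hder hint hlim

/-- Both sides are traces, of the two composites of `c` with the map `s ↦ ∑ j, s j • β j`. The left
side is the divergence of the linear field `s ↦ c (∑ j, s j • β j)`. -/
theorem trace_rightInverse {l N : ℕ} {β : Fin N → T l} {c : T l →ₗ[ℝ] (Fin N → ℝ)}
    (hc : ∀ x, ∑ j, c x j • β j = x) : ∑ j, c (β j) j = l := by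
  have h1 : (Fintype.linearCombination ℝ β) ∘ₗ c = LinearMap.id := by
    ext1 x
    simpa [Fintype.linearCombination_apply] using hc x
  have h2 := LinearMap.trace_comp_comm' c (Fintype.linearCombination ℝ β)
  rw [h1, LinearMap.trace_id, LinearMap.trace_eq_matrix_trace ℝ (Pi.basisFun ℝ (Fin N))] at h2
  simpa [Matrix.trace, LinearMap.toMatrix_apply, Fintype.linearCombination_apply_single]
    using h2.symm

/-- The recursion for truncated powers: the divergence theorem for the vector field
`s ↦ (s - c (∑ i, s i • β i)) g (∑ i, s i • β i)`, which is tangent to the fibres of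
`s ↦ ∑ i, s i • β i`. -/
theorem integral_orthant_recursion {l m : ℕ} {β : Fin (m + 1) → T l} {ξ : T l}
    (hξ : ∀ j, 0 < inner ℝ (β j) ξ) {c : T l →ₗ[ℝ] (Fin (m + 1) → ℝ)}
    (hc : ∀ x, ∑ j, c x j • β j = x) {g : T l → ℂ} (hg : ContDiff ℝ ∞ g)
    (hgc : HasCompactSupport g) :
    (((m : ℂ) + 1) - l) * ∫ s in {s : Fin (m + 1) → ℝ | ∀ j, 0 ≤ s j}, g (∑ i, s i • β i) =
      ∑ j, ∫ s in {s : Fin m → ℝ | ∀ j, 0 ≤ s j},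
        ((c (∑ i, s i • β (j.succAbove i)) j : ℝ) : ℂ) * g (∑ i, s i • β (j.succAbove i)) := by
  obtain ⟨R, hR⟩ := exists_bound_of_isCompact hξ hgc
  have hB : Continuous fun s : Fin (m + 1) → ℝ => ∑ i, s i • β i := by fun_prop
  have hcc : Continuous c := c.continuous_of_finiteDimensional
  have hcj : ∀ j, Continuous fun s : Fin (m + 1) → ℝ => c (∑ i, s i • β i) j := fun j =>
    (continuous_apply j).comp (hcc.comp hB)
  let f : Fin (m + 1) → (Fin (m + 1) → ℝ) → ℂ := fun j s =>
    ((s j - c (∑ i, s i • β i) j : ℝ) : ℂ) * g (∑ i, s i • β i)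
  let f' : Fin (m + 1) → (Fin (m + 1) → ℝ) → ℂ := fun j s =>
    ((1 - c (β j) j : ℝ) : ℂ) * g (∑ i, s i • β i) +
      ((s j - c (∑ i, s i • β i) j : ℝ) : ℂ) * fderiv ℝ g (∑ i, s i • β i) (β j)
  have hgd : Continuous (fderiv ℝ g) := hg.continuous_fderiv (by simp)
  have hf' : ∀ j, Continuous (f' j) := fun j => by
    refine (continuous_const.mul (hg.continuous.comp hB)).add
      ((Complex.continuous_ofReal.comp ((continuous_apply j).sub (hcj j))).mul ?_)
    exact (hgd.comp hB).clm_apply continuous_const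
  have hupd : ∀ (s : Fin (m + 1) → ℝ) j t,
      ∑ i, Function.update s j t i • β i = ∑ i, s i • β i + (t - s j) • β j := by
    intro s j t
    rw [← sub_eq_iff_eq_add', ← Finset.sum_sub_distrib]
    rw [Finset.sum_eq_single j]
    · simp [sub_smul]
    · intro i _ hi; simp [hi]
    · simp
  have hd : ∀ j s, HasDerivAt (fun t => f j (Function.update s j t)) (f' j s) (s j) := by
    intro j s
    have h1 : HasDerivAt (fun t : ℝ => ∑ i, s i • β i + (t - s j) • β j) (β j) (s j) := by
      simpa using (((hasDerivAt_id (s j)).sub_const (s j)).smul_const (β j)).const_add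
        (∑ i, s i • β i)
    have h2 : HasDerivAt (fun t : ℝ => g (∑ i, s i • β i + (t - s j) • β j))
        (fderiv ℝ g (∑ i, s i • β i) (β j)) (s j) := by
      have := (hg.differentiable (by simp) (∑ i, s i • β i + (s j - s j) • β j)).hasFDerivAt
      simpa using! this.comp_hasDerivAt (s j) h1
    have h3 : HasDerivAt (fun t : ℝ => t - c (∑ i, s i • β i + (t - s j) • β j) j)
        (1 - c (β j) j) (s j) := by
      have := (hasDerivAt_id (s j)).sub ((((hasDerivAt_id (s j)).sub_const (s j)).mul_const
        (c (β j) j)).const_add (c (∑ i, s i • β i) j))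
      simpa using! this
    have h4 := h3.ofReal_comp.mul h2
    simp only [sub_self, zero_smul, add_zero] at h4
    convert! h4 using 1
    ext t
    simp only [f, hupd, Function.update_self, Pi.mul_apply]
  have hz : ∀ s : Fin (m + 1) → ℝ, ∑ i, s i • β i ∉ tsupport g →
      g (∑ i, s i • β i) = 0 ∧ fderiv ℝ g (∑ i, s i • β i) = 0 := fun s hs =>
    ⟨image_eq_zero_of_notMem_tsupport hs, fderiv_of_notMem_tsupport ℝ hs⟩
  have hRf : ∀ j s, (∀ j, 0 ≤ s j) → f j s ≠ 0 → ∀ j, s j ≤ R := by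
    intro j s hs hn
    refine hR s hs ?_
    by_contra h
    simp [f, hz s h] at hn
  have hRf' : ∀ j s, (∀ j, 0 ≤ s j) → f' j s ≠ 0 → ∀ j, s j ≤ R := by
    intro j s hs hn
    refine hR s hs ?_
    by_contra h
    simp [f', hz s h] at hn
  -- The divergence of the field. The derivatives of `g` cancel because the field is tangent to the
  -- fibres, and the coefficients contribute `m + 1` minus the trace `l`.
  have hsum : ∀ s, ∑ j, f' j s = (((m : ℂ) + 1) - l) * g (∑ i, s i • β i) := by
    intro s
    have h1 : ∑ j, ((s j - c (∑ i, s i • β i) j : ℝ) : ℂ) * fderiv ℝ g (∑ i, s i • β i) (β j) =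
        0 := by
      have : ∑ j, (s j - c (∑ i, s i • β i) j) • β j = 0 := by
        simp only [sub_smul, Finset.sum_sub_distrib, hc, sub_self]
      have := congrArg (fderiv ℝ g (∑ i, s i • β i)) this
      simpa only [map_sum, map_smul, map_zero, Complex.real_smul] using this
    have h2 : ∑ j, ((1 - c (β j) j : ℝ) : ℂ) = ((m : ℂ) + 1) - l := by
      have := trace_rightInverse hc
      rw [← Complex.ofReal_sum, Finset.sum_sub_distrib, this]
      simp
    simp only [f', Finset.sum_add_distrib]
    rw [h1, ← Finset.sum_mul, h2, add_zero]
  rw [← integral_const_mul]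
  simp_rw [← hsum]
  rw [integral_finsetSum _ fun j _ => integrableOn_orthant (hf' j) (hRf' j)]
  refine Finset.sum_congr rfl fun j _ => ?_
  -- On the face `s j = 0` the coefficient `s j - c (⋯) j` is `-c (⋯) j`; its sign cancels that of
  -- the boundary term.
  rw [integral_orthant_deriv j (hf' j) (hd j) (hRf j) (hRf' j), ← integral_neg]
  congr 1
  ext s
  simp [f, Fin.sum_univ_succAbove _ j]

/-! ### Local polynomial densities of the cone measure. -/

/-- `p` is homogeneous of degree `d`; in negative degrees this means that `p = 0`. -/
def IsHomogeneousInt {l : ℕ} {R : Type*} [CommSemiring R] (p : MvPolynomial (Fin l) R) (d : ℤ) :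
    Prop :=
  p = 0 ∨ ∃ e : ℕ, (e : ℤ) = d ∧ p.IsHomogeneous e

/-- On the open cone `V` the measure `coneMeasure β` has the polynomial density `p`, when tested
against smooth functions with compact support. -/
structure HasPolynomialDensity {l N : ℕ} (β : Fin N → T l) (p : MvPolynomial (Fin l) ℝ)
    (V : Set (T l)) : Prop where
  isOpen : IsOpen V
  smul_mem : ∀ t : ℝ, 0 < t → ∀ x ∈ V, t • x ∈ V
  integral_eq : ∀ g : T l → ℂ, ContDiff ℝ ∞ g → HasCompactSupport g → tsupport g ⊆ V →
    ∫ s in {s : Fin N → ℝ | ∀ j, 0 ≤ s j}, g (∑ j, s j • β j) =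
      ∫ x, g x * ((MvPolynomial.eval x p : ℝ) : ℂ)

theorem continuous_eval {l : ℕ} (p : MvPolynomial (Fin l) ℝ) :
    Continuous fun x : T l => MvPolynomial.eval x p :=
  (MvPolynomial.continuous_eval p).comp (by fun_prop)

theorem hasPolynomialDensity_compl_cone {l N : ℕ} {β : Fin N → T l} {ξ : T l}
    (hξ : ∀ j, 0 < inner ℝ (β j) ξ) : HasPolynomialDensity β 0 (cone β Finset.univ)ᶜ where
  isOpen := (isClosed_cone hξ _).isOpen_compl
  smul_mem t ht x hx h := hx (by
    simpa [smul_smul, ht.ne'] using smul_mem_cone (inv_nonneg.2 ht.le) h)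
  integral_eq g hg hgc hgV := by
    have : ∀ s ∈ {s : Fin N → ℝ | ∀ j, 0 ≤ s j}, g (∑ j, s j • β j) = 0 := fun s hs =>
      image_eq_zero_of_notMem_tsupport fun h => hgV h ⟨s, hs, rfl⟩
    rw [setIntegral_congr_fun (by measurability) this]
    simp

theorem integral_comp_sum_smul {l : ℕ} {β : Fin l → T l} (hβ : LinearIndependent ℝ β)
    (b : OrthonormalBasis (Fin l) ℝ (T l)) (g : T l → ℂ) :
    ∫ s : Fin l → ℝ, g (∑ j, s j • β j) =
      ((1 / |(b.toBasis.toMatrix β).det| : ℝ) : ℂ) * ∫ x, g x := by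
  set e := EuclideanSpace.basisFun (Fin l) ℝ with he
  set M : T l →ₗ[ℝ] T l := e.toBasis.constr ℝ β with hM
  have hMe : ∀ j, M (e j) = β j := fun j => by
    have := e.toBasis.constr_basis ℝ β j
    rwa [OrthonormalBasis.coe_toBasis] at this
  have hMx : ∀ x : T l, M x = ∑ j, x j • β j := fun x => by
    simp [hM, Module.Basis.constr_apply_fintype, he]
  have hdet : |LinearMap.det M| = |(b.toBasis.toMatrix β).det| := by
    have h1 := b.toBasis.det_comp M e
    have h2 : (M ∘ e : Fin l → T l) = β := funext hMe
    rw [h2] at h1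
    rw [← Module.Basis.det_apply, h1, abs_mul]
    -- Two orthonormal bases differ by a determinant `±1`, so the absolute value does not depend on
    -- `b`.
    rcases b.det_to_matrix_orthonormalBasis_real e with h | h <;> simp [h]
  have hne : LinearMap.det M ≠ 0 := by
    intro h
    rw [h, abs_zero] at hdet
    have hb : IsUnit (b.toBasis.det β) := by
      refine (b.toBasis.is_basis_iff_det).1 ⟨hβ, ?_⟩
      exact hβ.span_eq_top_of_card_eq_finrank' (by simp)
    rw [Module.Basis.det_apply] at hb
    exact hb.ne_zero (abs_eq_zero.1 hdet.symm)
  have h1 : ∫ s : Fin l → ℝ, g (∑ j, s j • β j) = ∫ x : T l, g (M x) := by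
    rw [← (PiLp.volume_preserving_toLp (Fin l)).integral_comp
      (MeasurableEquiv.toLp 2 (Fin l → ℝ)).measurableEmbedding]
    simp [hMx]
  have hemb : MeasurableEmbedding M :=
    ((LinearEquiv.ofIsUnitDet (f := M) (v := e.toBasis) (v' := e.toBasis) (by
      rw [LinearMap.det_toMatrix]; exact hne.isUnit))
        |>.toContinuousLinearEquiv.toHomeomorph).measurableEmbedding
  rw [h1, ← hemb.integral_map (μ := volume), Measure.map_linearMap_addHaar_eq_smul_addHaar _ hne,
    integral_smul_measure, ENNReal.toReal_ofReal (abs_nonneg _), abs_inv, hdet]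
  simp

/-- `V` is the open simplicial cone. A test function supported there vanishes for `s` outside the
orthant, so the integral extends to all of `ℝ^l` and is a linear change of variables. -/
theorem hasPolynomialDensity_basis {l : ℕ} {β : Fin l → T l} (hβ : LinearIndependent ℝ β)
    {c : Fin l → ℝ} (hc : ∀ j, 0 < c j) (b : OrthonormalBasis (Fin l) ℝ (T l)) :
    ∃ V, ∑ j, c j • β j ∈ V ∧
      HasPolynomialDensity β (MvPolynomial.C (1 / |(b.toBasis.toMatrix β).det|)) V := by
  let B := basisOfLinearIndependentOfCardEqFinrank' β hβ (by simp)
  have hB : ∀ s : Fin l → ℝ, ∀ j, B.repr (∑ i, s i • β i) j = s j := fun s j => by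
    have : ∑ i, s i • β i = ∑ i, s i • B i := by simp [B]
    rw [this, B.repr_sum_self]
  refine ⟨{x | ∀ j, 0 < B.repr x j}, fun j => by rw [hB]; exact hc j, ?_, ?_, ?_⟩
  · simp only [Set.ofPred_forall]
    refine isOpen_iInter_of_finite fun j => isOpen_lt continuous_const ?_
    exact (B.coord j).continuous_of_finiteDimensional
  · intro t ht x hx j
    simpa using mul_pos ht (hx j)
  · intro g hg hgc hgV
    rw [setIntegral_eq_integral_of_forall_compl_eq_zero, integral_comp_sum_smul hβ b g]
    · simp [integral_mul_const, mul_comm]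
    · intro s hs
      refine image_eq_zero_of_notMem_tsupport fun h => hs fun j => ?_
      have h1 : 0 < B.repr (∑ i, s i • β i) j := hgV h j
      rw [hB] at h1
      exact h1.le

theorem isHomogeneousInt_sum_mul {l : ℕ} {ι : Type*} {R : Type*} [CommSemiring R] (s : Finset ι)
    {L q : ι → MvPolynomial (Fin l) R} {d : ℤ} (hL : ∀ i, (L i).IsHomogeneous 1)
    (hq : ∀ i, IsHomogeneousInt (q i) d) : IsHomogeneousInt (∑ i ∈ s, L i * q i) (d + 1) := by
  rcases lt_or_ge d 0 with hd | hd
  · left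
    refine Finset.sum_eq_zero fun i _ => ?_
    rcases hq i with h | ⟨e, he, -⟩
    · simp [h]
    · omega
  · lift d to ℕ using hd
    refine .inr ⟨1 + d, by push_cast; ring, MvPolynomial.IsHomogeneous.sum _ _ _ fun i _ =>
      (hL i).mul ?_⟩
    rcases hq i with h | ⟨e, he, h⟩
    · rw [h]; exact MvPolynomial.isHomogeneous_zero _ _ _
    · have : e = d := by exact_mod_cast he
      exact this ▸ h

theorem IsHomogeneousInt.C_mul {l : ℕ} {R : Type*} [CommSemiring R] {p : MvPolynomial (Fin l) R}
    {d : ℤ} (hp : IsHomogeneousInt p d) (a : R) : IsHomogeneousInt (MvPolynomial.C a * p) d := by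
  rcases hp with h | ⟨e, he, h⟩
  · left; simp [h]
  · exact .inr ⟨e, he, h.C_mul a⟩

/-- Induction on the number of weights. Off the full cone the density is zero. Inside it the weights
span, so `N ≥ l`: for `N = l` the cone is simplicial and the density constant, while for `N > l` the
recursion can be divided by `N - l`. Deleting a weight lowers the degree by one and the linear
coefficient restores it. -/
theorem exists_hasPolynomialDensity {l N : ℕ} {β : Fin N → T l} {ξ : T l}
    (hξ : ∀ j, 0 < inner ℝ (β j) ξ) {y : T l} (hy : y ∈ genericSet β) :
    ∃ p V, y ∈ V ∧ HasPolynomialDensity β p V ∧ IsHomogeneousInt p ((N : ℤ) - l) := by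
  induction N with
  | zero =>
    by_cases hc : y ∈ cone β Finset.univ
    · have hs := span_eq_top_of_mem_cone hy hc
      obtain rfl : l = 0 := by
        have := finrank_range_le_card (R := ℝ) β
        rw [Set.finrank, hs] at this
        simpa using this
      obtain ⟨V, hV, h⟩ := hasPolynomialDensity_basis (β := β) (c := 0)
        (linearIndependent_empty_type) (fun j => j.elim0) (EuclideanSpace.basisFun _ ℝ)
      exact ⟨_, V, by convert hV; exact Subsingleton.elim _ _, h,
        .inr ⟨0, by simp, MvPolynomial.isHomogeneous_C _ _⟩⟩
    · exact ⟨0, _, hc, hasPolynomialDensity_compl_cone hξ, .inl rfl⟩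
  | succ m ih =>
    by_cases hc : y ∈ cone β Finset.univ
    swap
    · exact ⟨0, _, hc, hasPolynomialDensity_compl_cone hξ, .inl rfl⟩
    have hs := span_eq_top_of_mem_cone hy hc
    have hlm : l ≤ m + 1 := by
      have := finrank_range_le_card (R := ℝ) β
      rw [Set.finrank, hs] at this
      simpa using this
    rcases hlm.eq_or_lt with rfl | hlt
    · have hβ : LinearIndependent ℝ β :=
        linearIndependent_of_top_le_span_of_card_eq_finrank hs.ge (by simp)
      obtain ⟨c, hc0, rfl⟩ := hc
      -- A vanishing coefficient would put `y` in a cone spanned by `l - 1` weights.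
      have hcpos : ∀ j, 0 < c j := fun j => (hc0 j).lt_of_ne fun h => by
        refine hy (Finset.univ.erase j) (by simp) ⟨c, hc0, ?_⟩
        rw [← Finset.add_sum_erase _ _ (Finset.mem_univ j), ← h]
        simp
      obtain ⟨V, hV, h⟩ := hasPolynomialDensity_basis hβ hcpos (EuclideanSpace.basisFun _ ℝ)
      exact ⟨_, V, hV, h, .inr ⟨0, by simp, MvPolynomial.isHomogeneous_C _ _⟩⟩
    · choose q V hyV hq hhom using fun j : Fin (m + 1) =>
        ih (β := fun i => β (j.succAbove i)) (fun i => hξ _) (mem_genericSet_succAbove hy j)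
      obtain ⟨c, hc⟩ := (Fintype.linearCombination ℝ β).exists_rightInverse_of_surjective
        (by rw [Fintype.range_linearCombination, hs])
      replace hc : ∀ x, ∑ j, c x j • β j = x := fun x => by
        simpa [Fintype.linearCombination_apply] using LinearMap.congr_fun hc x
      let L : Fin (m + 1) → MvPolynomial (Fin l) ℝ := fun j =>
        ∑ k, MvPolynomial.C (c (EuclideanSpace.single k 1) j) * MvPolynomial.X k
      have hL : ∀ j (x : T l), MvPolynomial.eval x (L j) = c x j := fun j x => by
        have : x = ∑ k, x k • EuclideanSpace.single k (1 : ℝ) := by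
          ext i; simp [Pi.single_apply]
        conv_rhs => rw [this]
        simp [L, mul_comm]
      have hL1 : ∀ j, (L j).IsHomogeneous 1 := fun j =>
        MvPolynomial.IsHomogeneous.sum _ _ _ fun k _ => by
          simpa using (MvPolynomial.isHomogeneous_X ℝ k).C_mul (c (EuclideanSpace.single k 1) j)
      have hne : ((m : ℝ) + 1 - l) ≠ 0 := by
        have : (l : ℝ) < m + 1 := by exact_mod_cast hlt
        linarith
      refine ⟨MvPolynomial.C ((m : ℝ) + 1 - l)⁻¹ * ∑ j, L j * q j, ⋂ j, V j, Set.mem_iInter.2 hyV,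
        ⟨isOpen_iInter_of_finite fun j => (hq j).isOpen, fun t ht x hx =>
          Set.mem_iInter.2 fun j => (hq j).smul_mem t ht x (Set.mem_iInter.1 hx j), ?_⟩, ?_⟩
      · intro g hg hgc hgV
        have hcc : ∀ j, ContDiff ℝ ∞ fun x : T l => ((c x j : ℝ) : ℂ) := fun j =>
          Complex.ofRealCLM.contDiff.comp
            ((LinearMap.proj j ∘ₗ c).toContinuousLinearMap.contDiff)
        have hj : ∀ j, ∫ s in {s : Fin m → ℝ | ∀ j, 0 ≤ s j},
            ((c (∑ i, s i • β (j.succAbove i)) j : ℝ) : ℂ) * g (∑ i, s i • β (j.succAbove i)) =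
            ∫ x, g x * ((MvPolynomial.eval x (L j * q j) : ℝ) : ℂ) := by
          intro j
          rw [(hq j).integral_eq (fun x => ((c x j : ℝ) : ℂ) * g x) ((hcc j).mul hg) hgc.mul_left
            ((tsupport_mul_subset_right).trans (hgV.trans (Set.iInter_subset _ j)))]
          congr 1 with x
          simp only [map_mul, hL, Complex.ofReal_mul]
          ring
        have hrec := integral_orthant_recursion hξ hc hg hgc
        simp_rw [hj] at hrec
        rw [← integral_finsetSum] at hrec
        · have hne' : ((m : ℂ) + 1 - l) ≠ 0 := by exact_mod_cast hne
          rw [← mul_right_inj' hne', hrec, ← integral_const_mul]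
          congr 1 with x
          simp only [map_mul, map_sum, MvPolynomial.eval_C, ← Finset.mul_sum]
          push_cast
          field_simp
        · intro j _
          refine Continuous.integrable_of_hasCompactSupport ?_ hgc.mul_right
          exact hg.continuous.mul (Complex.continuous_ofReal.comp (continuous_eval _))
      · have := (isHomogeneousInt_sum_mul Finset.univ hL1 hhom).C_mul ((m : ℝ) + 1 - l)⁻¹
        convert this using 1
        push_cast; ring

/-! ### The transform on a shifted contour and its inversion. -/

/-- The Fourier–Laplace transform `ζ ↦ ∫ A(x) e^{-i x(ζ)} dx` on `𝔱 ⊗ ℂ`. -/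
noncomputable def laplace {l : ℕ} (A : T l → ℂ) (ζ : Fin l → ℂ) : ℂ :=
  ∫ x, A x * Complex.exp (-Complex.I * pair x ζ)

theorem pair_shift {l : ℕ} (x ψ ξ : T l) :
    pair x (shift ψ ξ) = ((inner ℝ x ψ : ℝ) : ℂ) - Complex.I * ((inner ℝ x ξ : ℝ) : ℂ) := by
  simp only [pair, shift, PiLp.inner_apply, RCLike.inner_apply, conj_trivial, Complex.ofReal_sum,
    Complex.ofReal_mul, Finset.mul_sum, ← Finset.sum_sub_distrib]
  refine Finset.sum_congr rfl fun k _ => ?_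
  ring

theorem pair_smul_right {l : ℕ} (x : T l) (a : ℂ) (ζ : Fin l → ℂ) :
    pair x (a • ζ) = a * pair x ζ := by
  simp only [pair, Pi.smul_apply, smul_eq_mul, Finset.mul_sum]
  exact Finset.sum_congr rfl fun k _ => by ring

theorem pair_sub {l : ℕ} (x y : T l) (ζ : Fin l → ℂ) : pair (x - y) ζ = pair x ζ - pair y ζ := by
  simp [pair, sub_mul, Finset.sum_sub_distrib]

theorem pair_smul {l : ℕ} (t : ℝ) (x : T l) (ζ : Fin l → ℂ) : pair (t • x) ζ = t * pair x ζ := by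
  simp [pair, Finset.mul_sum, mul_assoc]

theorem pair_sum_smul {l N : ℕ} (β : Fin N → T l) (s : Fin N → ℝ) (ζ : Fin l → ℂ) :
    pair (∑ j, s j • β j) ζ = ∑ j, (s j : ℂ) * pair (β j) ζ := by
  simp only [pair, Finset.mul_sum, WithLp.ofLp_sum, WithLp.ofLp_smul, Finset.sum_apply,
    Pi.smul_apply, smul_eq_mul, Complex.ofReal_sum, Complex.ofReal_mul, Finset.sum_mul, mul_assoc]
  exact Finset.sum_comm

theorem contDiff_exp_pair {l : ℕ} (ζ : Fin l → ℂ) :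
    ContDiff ℝ ∞ fun x : T l => Complex.exp (-Complex.I * pair x ζ) := by
  have h : ∀ k, ContDiff ℝ ∞ fun x : T l => (x k : ℂ) := fun k =>
    Complex.ofRealCLM.contDiff.comp (contDiff_euclidean.1 contDiff_id k)
  exact Complex.contDiff_exp.comp (contDiff_const.mul
    (ContDiff.sum fun k _ => (h k).mul contDiff_const))

theorem fderiv_exp_pair {l : ℕ} (x v : T l) (ζ : Fin l → ℂ) :
    fderiv ℝ (fun x : T l => Complex.exp (-Complex.I * pair x ζ)) x v =
      -Complex.I * pair v ζ * Complex.exp (-Complex.I * pair x ζ) := by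
  have hd := ((contDiff_exp_pair ζ).differentiable (by simp) x).hasFDerivAt.hasLineDerivAt v
  refine hd.unique ?_
  have h1 : HasDerivAt (fun t : ℝ => -Complex.I * pair (x + t • v) ζ)
      (-Complex.I * pair v ζ) 0 := by
    have : HasDerivAt (fun t : ℝ => -Complex.I * (pair x ζ + t * pair v ζ))
        (-Complex.I * (1 * pair v ζ)) 0 :=
      (((Complex.ofRealCLM.hasDerivAt (x := 0)).mul_const _).const_add _).const_mul _
    convert! this using 1
    · ext t
      rw [← pair_smul]
      simp [pair, add_mul, Finset.sum_add_distrib]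
    · ring
  have := h1.cexp
  simp only [zero_smul, add_zero] at this
  rw [HasLineDerivAt, mul_comm]
  exact this

theorem laplace_fderiv {l : ℕ} {A : T l → ℂ} (hA : ContDiff ℝ ∞ A) (hAc : HasCompactSupport A)
    (y : T l) (ζ : Fin l → ℂ) :
    laplace (fun x => -Complex.I * fderiv ℝ A x y) ζ = pair y ζ * laplace A ζ := by
  have he := contDiff_exp_pair (l := l) ζ
  have hA' : Continuous fun x => fderiv ℝ A x y :=
    (hA.continuous_fderiv (by simp)).clm_apply continuous_const
  have he' : Continuous fun x => fderiv ℝ (fun x : T l => Complex.exp (-Complex.I * pair x ζ)) x y :=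
    (he.continuous_fderiv (by simp)).clm_apply continuous_const
  have hAc' : HasCompactSupport fun x => fderiv ℝ A x y :=
    (hAc.fderiv (𝕜 := ℝ)).comp_left (g := fun L : T l →L[ℝ] ℂ => L y) (by simp)
  have := integral_mul_fderiv_eq_neg_fderiv_mul_of_integrable (μ := (volume : Measure (T l)))
    (f := fun x : T l => Complex.exp (-Complex.I * pair x ζ)) (g := A) (v := y)
    ((he'.mul hA.continuous).integrable_of_hasCompactSupport hAc.mul_left)
    ((he.continuous.mul hA').integrable_of_hasCompactSupport hAc'.mul_left)
    ((he.continuous.mul hA.continuous).integrable_of_hasCompactSupport hAc.mul_left)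
    (fun x _ => he.differentiable (by simp) x) (fun x _ => hA.differentiable (by simp) x)
  simp only [fderiv_exp_pair] at this
  calc laplace (fun x => -Complex.I * fderiv ℝ A x y) ζ
      = -Complex.I * ∫ x, Complex.exp (-Complex.I * pair x ζ) * fderiv ℝ A x y := by
        rw [laplace, ← integral_const_mul]
        congr 1 with x
        ring
    _ = -Complex.I * -(-Complex.I * pair y ζ * laplace A ζ) := by
        rw [this, laplace, ← integral_const_mul]
        congr 3 with x
        ring
    _ = _ := by
        linear_combination (-pair y ζ * laplace A ζ) * Complex.I_mul_I

theorem laplace_smul {l : ℕ} (φ : T l → ℂ) {ε : ℝ} (hε : 0 < ε) (ζ : Fin l → ℂ) :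
    laplace (fun x => ((ε ^ l)⁻¹ : ℝ) * φ (ε⁻¹ • x)) ζ = laplace φ ((ε : ℂ) • ζ) := by
  have := Measure.integral_comp_smul (volume : Measure (T l))
    (fun x => φ x * Complex.exp (-Complex.I * pair x ((ε : ℂ) • ζ))) ε⁻¹
  simp only [finrank_euclideanSpace, Fintype.card_fin, inv_pow, inv_inv,
    abs_of_pos (pow_pos hε l)] at this
  rw [laplace, laplace]
  have hne : (((ε ^ l)⁻¹ : ℝ) : ℂ) ≠ 0 := by
    exact_mod_cast (inv_pos.2 (pow_pos hε l)).ne'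
  calc _ = (((ε ^ l)⁻¹ : ℝ) : ℂ) * ∫ x : T l, φ (ε⁻¹ • x) *
        Complex.exp (-Complex.I * pair (ε⁻¹ • x) ((ε : ℂ) • ζ)) := by
        rw [← integral_const_mul]
        congr 1 with x
        have : ((ε⁻¹ : ℝ) : ℂ) * ((ε : ℂ) * pair x ζ) = pair x ζ := by
          rw [← mul_assoc, ← Complex.ofReal_mul, inv_mul_cancel₀ hε.ne', Complex.ofReal_one,
            one_mul]
        rw [pair_smul, pair_smul_right, this]
        ring
    _ = _ := by
        rw [this, Complex.real_smul, ← mul_assoc, ← Complex.ofReal_mul,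
          inv_mul_cancel₀ (pow_pos hε l).ne', Complex.ofReal_one, one_mul]

/-- Restricted to `𝔱 ⊗ ℂ`, the Fourier transform of a test function on `𝔨*` is the transform of its
push-forward to `𝔱*`. -/
theorem exists_marginal {l n : ℕ} {χ : Amb l n → ℝ} (hχ : ContDiff ℝ ∞ χ)
    (hχc : HasCompactSupport χ) :
    ∃ φ : T l → ℂ, ContDiff ℝ ∞ φ ∧ HasCompactSupport φ ∧ ∀ ζ, fourierAt χ ζ = laplace φ ζ := by
  let e := (EuclideanSpace.sumEquivProd (𝕜 := ℝ) (ι := Fin l) (κ := Fin n)).symm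
  have hemp : MeasurePreserving e (volume.prod volume) volume :=
    (PiLp.sumPiLpEquivProdLpPiLp 2 (fun _ : Fin l ⊕ Fin n => ℝ)).symm.measurePreserving.comp
      (WithLp.volume_preserving_toLp (T l) (EuclideanSpace ℝ (Fin n)))
  have hei : ∀ x w k, e (x, w) (Sum.inl k) = x k := fun x w k => rfl
  set c : ℂ := (((2 * π) ^ (-(((l + n : ℕ) : ℝ) / 2)) : ℝ) : ℂ) with hc
  have hχe : ContDiff ℝ ∞ fun q : T l × EuclideanSpace ℝ (Fin n) => (χ (e q) : ℂ) :=
    Complex.ofRealCLM.contDiff.comp (hχ.comp e.contDiff)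
  have hK : IsCompact (e.symm '' tsupport χ) := hχc.image e.symm.continuous
  have hKz : ∀ q, χ (e q) ≠ 0 → q ∈ e.symm '' tsupport χ := fun q hq =>
    ⟨e q, subset_tsupport _ hq, by simp⟩
  have hχec : HasCompactSupport fun q : T l × EuclideanSpace ℝ (Fin n) => (χ (e q) : ℂ) :=
    HasCompactSupport.intro hK fun q hq => by
      by_contra h
      exact hq (hKz q (by simpa using h))
  let Φ : T l → ℂ := fun x => ∫ w, (χ (e (x, w)) : ℂ)
  have hΦ : ContDiff ℝ ∞ Φ := by
    -- The fibre integral is the value at `0` of a convolution with the constant `1`, whence the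
    -- reflection `w ↦ -w`; smooth dependence on the parameter `x` is then available.
    have h := contDiffOn_convolution_right_with_param_comp (n := ⊤) (μ := volume)
      (ContinuousLinearMap.mul ℝ ℂ) (s := (Set.univ : Set (T l)))
      (v := fun _ => (0 : EuclideanSpace ℝ (Fin n))) contDiffOn_const
      (f := fun _ => (1 : ℂ)) (g := fun x w => (χ (e (x, -w)) : ℂ))
      (k := (fun q => -q.2) '' (e.symm '' tsupport χ)) isOpen_univ
      (hK.image (by fun_prop)) (fun p x _ hx => by
        by_contra h
        exact hx ⟨_, hKz (p, -x) (by simpa using h), by simp⟩)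
      (continuous_const.locallyIntegrable)
      ((hχe.comp (f := fun q : T l × EuclideanSpace ℝ (Fin n) => (q.1, -q.2))
        (by fun_prop)).contDiffOn)
    rw [contDiffOn_univ] at h
    convert! h using 2 with x
    simp [Φ, convolution_def]
  refine ⟨fun x => c * Φ x, contDiff_const.mul hΦ, ?_, fun ζ => ?_⟩
  · refine HasCompactSupport.intro (hK.image continuous_fst) fun x hx => ?_
    have : ∀ w, (χ (e (x, w)) : ℂ) = 0 := fun w => by
      by_contra h
      exact hx ⟨_, hKz (x, w) (by simpa using h), rfl⟩
    simp [Φ, this]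
  · rw [fourierAt, ← hemp.integral_comp e.toHomeomorph.measurableEmbedding, integral_prod, laplace,
      ← integral_const_mul]
    · congr 1 with x
      simp only [hei, integral_mul_const, Φ, pair]
      ring
    · refine Continuous.integrable_of_hasCompactSupport ?_ hχec.mul_right
      refine hχe.continuous.mul (Complex.continuous_exp.comp (continuous_const.mul ?_))
      simp only [hei]
      fun_prop

/-- Moving the contour by `-iξ` multiplies `A` by `e^{-x(ξ)}`, which is harmless on a compact
support. The transform is thus an ordinary Fourier transform of a Schwartz function, which gives
both decay and inversion. -/
theorem laplace_shift {l : ℕ} {A : T l → ℂ} (hA : ContDiff ℝ ∞ A) (hAc : HasCompactSupport A)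
    (ξ : T l) : ∃ f : SchwartzMap (T l) ℂ, (∀ x, f x = A x * Complex.exp (-(inner ℝ x ξ : ℝ))) ∧
      ∀ ψ, laplace A (shift ψ ξ) = FourierTransform.fourier f ((2 * π)⁻¹ • ψ) := by
  have hf : ContDiff ℝ ∞ fun x : T l => A x * Complex.exp (-((inner ℝ x ξ : ℝ) : ℂ)) := by
    refine hA.mul (Complex.contDiff_exp.comp (ContDiff.neg ?_))
    exact Complex.ofRealCLM.contDiff.comp (contDiff_id.inner ℝ contDiff_const)
  refine ⟨(hAc.mul_right (f' := fun x : T l =>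
    Complex.exp (-((inner ℝ x ξ : ℝ) : ℂ)))).toSchwartzMap hf, fun x => rfl, fun ψ => ?_⟩
  rw [SchwartzMap.fourier_coe, Real.fourier_eq', laplace]
  congr 1 with x
  rw [pair_shift]
  simp only [HasCompactSupport.toSchwartzMap_toFun, smul_eq_mul, Pi.mul_apply]
  rw [mul_comm _ (A x * _), mul_assoc, ← Complex.exp_add]
  congr 2
  rw [inner_smul_right]
  push_cast
  have : (π : ℂ) ≠ 0 := by exact_mod_cast Real.pi_ne_zero
  field_simp
  linear_combination ((inner ℝ x ξ : ℝ) : ℂ) * Complex.I_sq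

theorem integrable_laplace_shift {l : ℕ} {A : T l → ℂ} (hA : ContDiff ℝ ∞ A)
    (hAc : HasCompactSupport A) (ξ : T l) : Integrable fun ψ => laplace A (shift ψ ξ) := by
  obtain ⟨f, -, hf⟩ := laplace_shift hA hAc ξ
  simp_rw [hf]
  exact (FourierTransform.fourier f).integrable.comp_smul (by positivity)

theorem laplace_inversion {l : ℕ} {A : T l → ℂ} (hA : ContDiff ℝ ∞ A) (hAc : HasCompactSupport A)
    (ξ x : T l) :
    ∫ ψ, laplace A (shift ψ ξ) * Complex.exp (Complex.I * pair x (shift ψ ξ)) =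
      (2 * (π : ℂ)) ^ l * A x := by
  obtain ⟨f, hfx, hf⟩ := laplace_shift hA hAc ξ
  have h1 : FourierTransform.fourierInv (FourierTransform.fourier f) x = f x := by
    rw [FourierTransform.fourierInv_fourier_eq]
  rw [SchwartzMap.fourierInv_coe, Real.fourierInv_eq'] at h1
  have h2 := Measure.integral_comp_smul (volume : Measure (T l)) (fun w =>
    Complex.exp ((2 * π * inner ℝ w x : ℝ) * Complex.I) • FourierTransform.fourier f w) (2 * π)⁻¹
  rw [h1, hfx] at h2
  simp only [finrank_euclideanSpace, Fintype.card_fin, inv_pow, inv_inv,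
    abs_of_pos (pow_pos Real.two_pi_pos l), smul_eq_mul, ← hf, Complex.real_smul] at h2
  have h3 : Complex.exp (-((inner ℝ x ξ : ℝ) : ℂ)) * Complex.exp (inner ℝ x ξ : ℝ) = 1 := by
    rw [← Complex.exp_add]; simp
  calc _ = (∫ ψ, Complex.exp ((2 * π * inner ℝ ((2 * π)⁻¹ • ψ) x : ℝ) * Complex.I) *
        laplace A (shift ψ ξ)) * Complex.exp (inner ℝ x ξ : ℝ) := by
        rw [← integral_mul_const]
        congr 1 with ψ
        rw [pair_shift, mul_comm (Complex.exp _) (laplace _ _), mul_assoc, ← Complex.exp_add]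
        congr 2
        rw [inner_smul_left, real_inner_comm]
        push_cast
        have : (π : ℂ) ≠ 0 := by exact_mod_cast Real.pi_ne_zero
        simp only [conj_trivial]
        push_cast
        field_simp
        linear_combination -((inner ℝ x ξ : ℝ) : ℂ) * Complex.I_sq
    _ = _ := by
        rw [h2]
        push_cast
        linear_combination (2 * (π : ℂ)) ^ l * A x * h3

/-! ### The denominator as an integral over the orthant. -/

theorem orthant_restrict_eq_pi (N : ℕ) :
    (volume : Measure (Fin N → ℝ)).restrict {s | ∀ j, 0 ≤ s j} =
      Measure.pi fun _ => (volume : Measure ℝ).restrict (Set.Ici 0) := by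
  rw [← Measure.restrict_pi_pi, volume_pi]
  congr 1
  ext s
  simp [Pi.le_def]

theorem integrable_exp_orthant {N : ℕ} {a : Fin N → ℂ} (ha : ∀ j, (a j).re < 0) :
    Integrable (fun s : Fin N → ℝ => Complex.exp (∑ j, (s j : ℂ) * a j))
      (volume.restrict {s | ∀ j, 0 ≤ s j}) := by
  simp_rw [Complex.exp_sum, orthant_restrict_eq_pi]
  refine Integrable.fintype_prod (f := fun j (t : ℝ) => Complex.exp ((t : ℂ) * a j)) fun j => ?_
  have := integrableOn_exp_mul_complex_Ioi (ha j) 0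
  rw [← IntegrableOn, integrableOn_Ici_iff_integrableOn_Ioi]
  simpa only [mul_comm] using this

theorem integral_exp_orthant {N : ℕ} {a : Fin N → ℂ} (ha : ∀ j, (a j).re < 0) :
    ∫ s in {s : Fin N → ℝ | ∀ j, 0 ≤ s j}, Complex.exp (∑ j, (s j : ℂ) * a j) =
      ∏ j, (-(a j)⁻¹) := by
  simp_rw [Complex.exp_sum, orthant_restrict_eq_pi]
  rw [integral_fintype_prod_eq_prod (f := fun j (t : ℝ) => Complex.exp ((t : ℂ) * a j))]
  refine Finset.prod_congr rfl fun j _ => ?_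
  rw [integral_Ici_eq_integral_Ioi]
  have := integral_exp_mul_complex_Ioi (ha j) 0
  simp only [mul_comm _ (a j)]
  rw [this]
  simp [neg_div]

theorem re_neg_I_mul_pair_shift {l : ℕ} (x ψ ξ : T l) :
    (-Complex.I * pair x (shift ψ ξ)).re = -inner ℝ x ξ := by
  rw [pair_shift]
  simp

theorem inner_le_norm_pair_shift {l : ℕ} (x ψ ξ : T l) :
    inner ℝ x ξ ≤ ‖pair x (shift ψ ξ)‖ := by
  have := (neg_le_abs _).trans (Complex.abs_re_le_norm (-Complex.I * pair x (shift ψ ξ)))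
  rw [re_neg_I_mul_pair_shift] at this
  simpa using this

/-- A product of one-variable integrals `1/b = i ∫_0^∞ e^{-isb} ds`, convergent since `b = β_j(ψ -
iξ)` has imaginary part `-β_j(ξ) < 0`. -/
theorem inv_prod_pair_shift {l N : ℕ} {β : Fin N → T l} {ξ : T l}
    (hξ : ∀ j, 0 < inner ℝ (β j) ξ) (ψ : T l) :
    (∏ j, pair (β j) (shift ψ ξ))⁻¹ = Complex.I ^ N *
      ∫ s in {s : Fin N → ℝ | ∀ j, 0 ≤ s j},
        Complex.exp (-Complex.I * pair (∑ j, s j • β j) (shift ψ ξ)) := by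
  have h : ∀ s : Fin N → ℝ, -Complex.I * pair (∑ j, s j • β j) (shift ψ ξ) =
      ∑ j, (s j : ℂ) * (-Complex.I * pair (β j) (shift ψ ξ)) := fun s => by
    rw [pair_sum_smul, Finset.mul_sum]
    exact Finset.sum_congr rfl fun j _ => by ring
  simp_rw [h]
  rw [integral_exp_orthant fun j => by rw [re_neg_I_mul_pair_shift]; linarith [hξ j]]
  have : Complex.I ^ N = ∏ _j : Fin N, Complex.I := by simp
  rw [this, ← Finset.prod_mul_distrib, ← Finset.prod_inv_distrib]
  refine Finset.prod_congr rfl fun j _ => ?_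
  rw [neg_mul, inv_neg, neg_neg, mul_inv, ← mul_assoc, mul_inv_cancel₀ Complex.I_ne_zero, one_mul]

theorem continuous_pair_shift {l : ℕ} {X : Type*} [TopologicalSpace X] {f g : X → T l}
    (hf : Continuous f) (hg : Continuous g) (ξ : T l) :
    Continuous fun q => pair (f q) (shift (g q) ξ) := by
  simp_rw [pair_shift]
  fun_prop

theorem integrable_laplace_mul_exp {l : ℕ} {A : T l → ℂ} (hA : ContDiff ℝ ∞ A)
    (hAc : HasCompactSupport A) (ξ z : T l) :
    Integrable fun ψ => laplace A (shift ψ ξ) * Complex.exp (Complex.I * pair z (shift ψ ξ)) := by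
  refine (integrable_laplace_shift hA hAc ξ).mul_bdd (c := Real.exp (inner ℝ z ξ))
    (Continuous.aestronglyMeasurable ?_) (.of_forall fun ψ => ?_)
  · exact Complex.continuous_exp.comp
      (continuous_const.mul (continuous_pair_shift continuous_const continuous_id ξ))
  · have := re_neg_I_mul_pair_shift z ψ ξ
    rw [neg_mul, Complex.neg_re, neg_inj] at this
    rw [Complex.norm_exp, this]

/-- On the contour `|β_j|` is at least `β_j(ξ) > 0`, so the inverse of the product is bounded. -/
theorem integrable_laplace_div {l N : ℕ} {β : Fin N → T l} {ξ : T l}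
    (hξ : ∀ j, 0 < inner ℝ (β j) ξ) {A : T l → ℂ} (hA : ContDiff ℝ ∞ A)
    (hAc : HasCompactSupport A) (z : T l) :
    Integrable fun ψ => laplace A (shift ψ ξ) * Complex.exp (Complex.I * pair z (shift ψ ξ)) *
      (∏ j, pair (β j) (shift ψ ξ))⁻¹ := by
  have hne : ∀ j ψ, pair (β j) (shift ψ ξ) ≠ 0 := fun j ψ h => by
    have := inner_le_norm_pair_shift (β j) ψ ξ
    rw [h, norm_zero] at this
    exact (hξ j).not_ge this
  refine (integrable_laplace_mul_exp hA hAc ξ z).mul_bdd (c := (∏ j, inner ℝ (β j) ξ)⁻¹)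
    (Continuous.aestronglyMeasurable ?_) (.of_forall fun ψ => ?_)
  · refine Continuous.inv₀ (continuous_finsetProd _ fun j _ =>
      continuous_pair_shift continuous_const continuous_id ξ) fun ψ => ?_
    exact Finset.prod_ne_zero_iff.2 fun j _ => hne j ψ
  · rw [norm_inv, norm_prod]
    exact inv_anti₀ (Finset.prod_pos fun j _ => hξ j) (Finset.prod_le_prod (fun j _ => (hξ j).le)
      fun j _ => inner_le_norm_pair_shift _ _ _)

/-- Expand the denominator, exchange the integrals, and apply inversion at each point `z - ∑ j, s j
• β j`. -/
theorem integral_laplace_div {l N : ℕ} {β : Fin N → T l} {ξ : T l}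
    (hξ : ∀ j, 0 < inner ℝ (β j) ξ) {A : T l → ℂ} (hA : ContDiff ℝ ∞ A)
    (hAc : HasCompactSupport A) (z : T l) :
    ∫ ψ, laplace A (shift ψ ξ) * Complex.exp (Complex.I * pair z (shift ψ ξ)) *
      (∏ j, pair (β j) (shift ψ ξ))⁻¹ =
    Complex.I ^ N * (2 * (π : ℂ)) ^ l *
      ∫ s in {s : Fin N → ℝ | ∀ j, 0 ≤ s j}, A (z - ∑ j, s j • β j) := by
  set μ : Measure (Fin N → ℝ) := volume.restrict {s | ∀ j, 0 ≤ s j} with hμ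
  have hB : Continuous fun s : Fin N → ℝ => ∑ j, s j • β j := by fun_prop
  have hf := integrable_laplace_mul_exp hA hAc ξ z
  have hh : Integrable (fun s : Fin N → ℝ => Real.exp (-inner ℝ (∑ j, s j • β j) ξ)) μ := by
    refine (integrable_exp_orthant (a := fun j => ((-inner ℝ (β j) ξ : ℝ) : ℂ))
      fun j => by simpa using hξ j).norm.congr (.of_forall fun s => ?_)
    simp [Complex.norm_exp, sum_inner, inner_smul_left]
  have hint : Integrable (Function.uncurry fun (ψ : T l) (s : Fin N → ℝ) =>
      laplace A (shift ψ ξ) * Complex.exp (Complex.I * pair z (shift ψ ξ)) *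
        Complex.exp (-Complex.I * pair (∑ j, s j • β j) (shift ψ ξ))) (volume.prod μ) := by
    refine (hf.norm.mul_prod hh).mono' (hf.aestronglyMeasurable.comp_fst.mul
      (Continuous.aestronglyMeasurable ?_)) (.of_forall fun q => ?_)
    · exact Complex.continuous_exp.comp (continuous_const.mul
        (continuous_pair_shift (hB.comp continuous_snd) continuous_fst ξ))
    · rw [Function.uncurry, norm_mul, Complex.norm_exp (-Complex.I * _), re_neg_I_mul_pair_shift]
  calc _ = Complex.I ^ N * ∫ ψ, ∫ s, laplace A (shift ψ ξ) *
        Complex.exp (Complex.I * pair z (shift ψ ξ)) *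
        Complex.exp (-Complex.I * pair (∑ j, s j • β j) (shift ψ ξ)) ∂μ := by
        rw [← integral_const_mul]
        congr 1 with ψ
        rw [inv_prod_pair_shift hξ, integral_const_mul]
        ring
    _ = Complex.I ^ N * ∫ s, (2 * (π : ℂ)) ^ l * A (z - ∑ j, s j • β j) ∂μ := by
        rw [integral_integral_swap hint]
        congr 2 with s
        rw [← laplace_inversion hA hAc ξ]
        congr 1 with ψ
        rw [mul_assoc, ← Complex.exp_add, pair_sub]
        congr 2
        ring
    _ = _ := by rw [integral_const_mul, mul_assoc]

/-! ### Differential operators on polynomials and the regularized residue. -/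

/-- The value of a complex polynomial at a real point. -/
noncomputable def evalReal {l : ℕ} (P : MvPolynomial (Fin l) ℂ) (x : T l) : ℂ :=
  MvPolynomial.eval (fun k => (x k : ℂ)) P

theorem evalReal_map {l : ℕ} (p : MvPolynomial (Fin l) ℝ) (x : T l) :
    evalReal (p.map Complex.ofRealHom) x = ((MvPolynomial.eval x p : ℝ) : ℂ) := by
  rw [evalReal, MvPolynomial.eval_map, ← Complex.ofRealHom_eq_coe (MvPolynomial.eval _ p),
    MvPolynomial.eval, MvPolynomial.coe_eval₂Hom, MvPolynomial.hom_eval₂]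
  simp

/-- The derivative of polynomials in the direction `y`. -/
noncomputable def dirDeriv {l : ℕ} (y : T l) :
    Derivation ℂ (MvPolynomial (Fin l) ℂ) (MvPolynomial (Fin l) ℂ) :=
  MvPolynomial.mkDerivation ℂ fun k => MvPolynomial.C (y k : ℂ)

theorem dirDeriv_comm {l : ℕ} (x y : T l) (P : MvPolynomial (Fin l) ℂ) :
    dirDeriv x (dirDeriv y P) = dirDeriv y (dirDeriv x P) := by
  have : ⁅dirDeriv x, dirDeriv y⁆ = 0 :=
    MvPolynomial.derivation_ext fun k => by simp [Derivation.commutator_apply, dirDeriv]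
  have := congrArg (fun D => D P) this
  simpa [Derivation.commutator_apply, sub_eq_zero] using this

theorem contDiff_evalReal {l : ℕ} (P : MvPolynomial (Fin l) ℂ) : ContDiff ℝ ∞ (evalReal P) := by
  unfold evalReal
  induction P using MvPolynomial.induction_on with
  | C a => simpa using! contDiff_const
  | add p q hp hq => simpa using! hp.add hq
  | mul_X p k hp =>
    simpa using! hp.mul (Complex.ofRealCLM.contDiff.comp (contDiff_euclidean.1 contDiff_id k))

theorem hasLineDerivAt_evalReal {l : ℕ} (P : MvPolynomial (Fin l) ℂ) (x y : T l) :
    HasLineDerivAt ℝ (evalReal P) (evalReal (dirDeriv y P) x) x y := by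
  rw [HasLineDerivAt]
  induction P using MvPolynomial.induction_on with
  | C a =>
    have : dirDeriv y (MvPolynomial.C a) = 0 := MvPolynomial.derivation_C _ _
    simpa [evalReal, this] using hasDerivAt_const (0 : ℝ) a
  | add p q hp hq => simpa [evalReal] using! hp.add hq
  | mul_X p k hp =>
    have hX : dirDeriv y (MvPolynomial.X k) = MvPolynomial.C (y k : ℂ) :=
      MvPolynomial.mkDerivation_X _ _ _
    have h1 : HasDerivAt (fun t : ℝ => ((x + t • y) k : ℂ)) (y k : ℂ) 0 := by
      have : HasDerivAt (fun t : ℝ => (x k : ℂ) + t * y k) (1 * (y k : ℂ)) 0 :=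
        ((Complex.ofRealCLM.hasDerivAt (x := 0)).mul_const _).const_add _
      simpa using this
    have := hp.mul h1
    simp only [zero_smul, add_zero] at this
    convert! this using 1
    · ext t
      simp [evalReal]
    · simp [evalReal, hX]
      ring

theorem fderiv_evalReal {l : ℕ} (P : MvPolynomial (Fin l) ℂ) (x y : T l) :
    fderiv ℝ (evalReal P) x y = evalReal (dirDeriv y P) x :=
  ((contDiff_evalReal P).differentiable (by simp) x).hasFDerivAt.hasLineDerivAt y |>.unique
    (hasLineDerivAt_evalReal P x y)

/-- On the mollifiers obtained by rescaling `φ`, multiplication of the transform by `a` is a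
differential operator with constant coefficients, acting on polynomials as `𝒜`. -/
structure HasSymbol {l : ℕ} (φ : T l → ℂ) (a : (Fin l → ℂ) → ℂ)
    (𝒜 : MvPolynomial (Fin l) ℂ →ₗ[ℂ] MvPolynomial (Fin l) ℂ) : Prop where
  comm : ∀ y q, 𝒜 (dirDeriv y q) = dirDeriv y (𝒜 q)
  exists_kernel : ∃ R : ℝ, ∀ ε : ℝ, 0 < ε → ∃ A : T l → ℂ, ContDiff ℝ ∞ A ∧
    tsupport A ⊆ Metric.closedBall 0 (R * ε) ∧
    (∀ ζ, laplace A ζ = a ζ * laplace φ ((ε : ℂ) • ζ)) ∧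
    ∀ q z, ∫ x, A x * evalReal q (z - x) = ∫ x, φ x * evalReal (𝒜 q) (z - ε • x)

theorem HasSymbol.one {l : ℕ} {φ : T l → ℂ} (hφ : ContDiff ℝ ∞ φ) (hφc : HasCompactSupport φ) :
    HasSymbol φ (fun _ => 1) LinearMap.id := by
  obtain ⟨R, hR⟩ := hφc.isCompact.isBounded.subset_closedBall 0
  refine ⟨fun _ _ => rfl, R, fun ε hε => ⟨fun x => ((ε ^ l)⁻¹ : ℝ) * φ (ε⁻¹ • x),
    contDiff_const.mul (hφ.comp (contDiff_const_smul _)), ?_, fun ζ => ?_, fun q z => ?_⟩⟩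
  · refine closure_minimal (fun x hx => ?_) Metric.isClosed_closedBall
    have : φ (ε⁻¹ • x) ≠ 0 := right_ne_zero_of_mul hx
    have := hR (subset_tsupport _ this)
    rw [mem_closedBall_zero_iff, norm_smul, norm_inv, Real.norm_of_nonneg hε.le,
      inv_mul_le_iff₀ hε] at this
    rw [mem_closedBall_zero_iff]
    linarith
  · rw [laplace_smul φ hε, one_mul]
  · have := Measure.integral_comp_smul (volume : Measure (T l))
      (fun x => φ x * evalReal q (z - ε • x)) ε⁻¹
    simp only [finrank_euclideanSpace, Fintype.card_fin, inv_pow, inv_inv,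
      abs_of_pos (pow_pos hε l), smul_smul, mul_inv_cancel₀ hε.ne', one_smul] at this
    simp only [mul_assoc, integral_const_mul, this, Complex.real_smul, LinearMap.id_apply]
    rw [← mul_assoc, ← Complex.ofReal_mul, inv_mul_cancel₀ (pow_pos hε l).ne', Complex.ofReal_one,
      one_mul]

theorem HasSymbol.const_mul {l : ℕ} {φ : T l → ℂ} {a : (Fin l → ℂ) → ℂ}
    {𝒜 : MvPolynomial (Fin l) ℂ →ₗ[ℂ] MvPolynomial (Fin l) ℂ} (h : HasSymbol φ a 𝒜) (c : ℂ) :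
    HasSymbol φ (fun ζ => c * a ζ) (c • 𝒜) := by
  obtain ⟨R, hR⟩ := h.exists_kernel
  refine ⟨fun y q => by simp [h.comm], R, fun ε hε => ?_⟩
  obtain ⟨A, hA, hAs, hAl, hAq⟩ := hR ε hε
  refine ⟨fun x => c * A x, contDiff_const.mul hA, tsupport_mul_subset_right.trans hAs,
    fun ζ => ?_, fun q z => ?_⟩
  · have := hAl ζ
    rw [laplace] at this ⊢
    simp only [mul_assoc, integral_const_mul, this]
  · simp only [mul_assoc, integral_const_mul, hAq]
    simp only [evalReal, LinearMap.smul_apply, MvPolynomial.smul_eval, mul_left_comm _ c,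
      integral_const_mul]

/-- The new kernel is `-i ∂_y A`. Integration by parts moves `∂_y` onto `q (z - x)`, where the sign
of the argument cancels that of the integration by parts; `comm` then carries it past `𝒜`. -/
theorem HasSymbol.pair_mul {l : ℕ} {φ : T l → ℂ} {a : (Fin l → ℂ) → ℂ}
    {𝒜 : MvPolynomial (Fin l) ℂ →ₗ[ℂ] MvPolynomial (Fin l) ℂ} (h : HasSymbol φ a 𝒜) (y : T l) :
    HasSymbol φ (fun ζ => pair y ζ * a ζ)
      (-Complex.I • (dirDeriv y : _ →ₗ[ℂ] MvPolynomial (Fin l) ℂ) ∘ₗ 𝒜) := by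
  obtain ⟨R, hR⟩ := h.exists_kernel
  refine ⟨fun x q => by simp [h.comm, dirDeriv_comm x y], R, fun ε hε => ?_⟩
  obtain ⟨A, hA, hAs, hAl, hAq⟩ := hR ε hε
  have hAc : HasCompactSupport A :=
    (isCompact_closedBall (0 : T l) (R * ε)).of_isClosed_subset (isClosed_tsupport A) hAs
  have hA' : ContDiff ℝ ∞ fun x => fderiv ℝ A x y :=
    (hA.fderiv_right (m := ∞) (by simp)).clm_apply contDiff_const
  have hAc' : HasCompactSupport fun x => fderiv ℝ A x y :=
    (hAc.fderiv (𝕜 := ℝ)).comp_left (g := fun L : T l →L[ℝ] ℂ => L y) (by simp)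
  refine ⟨fun x => -Complex.I * fderiv ℝ A x y, contDiff_const.mul hA', ?_, fun ζ => ?_,
    fun q z => ?_⟩
  · refine (tsupport_mul_subset_right.trans ?_).trans hAs
    refine closure_minimal (fun x hx => ?_) (isClosed_tsupport A)
    by_contra hn
    exact hx (by simp [fderiv_of_notMem_tsupport ℝ hn])
  · rw [laplace_fderiv hA hAc, hAl, mul_assoc]
  · have hq : ContDiff ℝ ∞ fun x : T l => evalReal q (z - x) :=
      (contDiff_evalReal q).comp (contDiff_const.sub contDiff_id)
    have hqd : ∀ x, fderiv ℝ (fun x : T l => evalReal q (z - x)) x y =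
        -evalReal (dirDeriv y q) (z - x) := fun x => by
      have h1 : HasFDerivAt (fun x : T l => z - x) (-ContinuousLinearMap.id ℝ (T l)) x :=
        (hasFDerivAt_id x).const_sub z
      have h2 := ((contDiff_evalReal q).differentiable (by simp) (z - x)).hasFDerivAt.comp x h1
      have := h2.fderiv
      simp only [Function.comp_def] at this
      rw [this]
      simp [fderiv_evalReal]
    have hq' : Continuous fun x => fderiv ℝ (fun x : T l => evalReal q (z - x)) x y :=
      (hq.continuous_fderiv (by simp)).clm_apply continuous_const
    have := integral_mul_fderiv_eq_neg_fderiv_mul_of_integrable (μ := (volume : Measure (T l)))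
      (f := fun x : T l => evalReal q (z - x)) (g := A) (v := y)
      ((hq'.mul hA.continuous).integrable_of_hasCompactSupport hAc.mul_left)
      ((hq.continuous.mul hA'.continuous).integrable_of_hasCompactSupport hAc'.mul_left)
      ((hq.continuous.mul hA.continuous).integrable_of_hasCompactSupport hAc.mul_left)
      (fun x _ => hq.differentiable (by simp) x) (fun x _ => hA.differentiable (by simp) x)
    simp only [hqd, neg_mul, integral_neg, neg_neg] at this
    simp only [mul_comm (evalReal _ _)] at this
    simp only [mul_assoc, integral_const_mul, this, hAq, h.comm]
    simp only [evalReal, LinearMap.smul_apply, LinearMap.comp_apply, MvPolynomial.smul_eval,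
      mul_left_comm (φ _), integral_const_mul, Derivation.coeFn_coe]

theorem tendsto_mollified_evalReal {l : ℕ} {φ : T l → ℂ} (hφ : Continuous φ)
    (hφc : HasCompactSupport φ) (P : MvPolynomial (Fin l) ℂ) (z : T l) :
    Tendsto (fun ε : ℝ => ∫ x, φ x * evalReal P (z - ε • x)) (𝓝[>] 0)
      (𝓝 ((∫ x, φ x) * evalReal P z)) := by
  have hP := (contDiff_evalReal P).continuous
  have h1 : ∀ ε : ℝ, ∫ x in tsupport φ, φ x * evalReal P (z - ε • x) =
      ∫ x, φ x * evalReal P (z - ε • x) := fun ε =>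
    setIntegral_eq_integral_of_forall_compl_eq_zero fun x hx => by
      simp [image_eq_zero_of_notMem_tsupport hx]
  have h2 : Continuous fun ε : ℝ => ∫ x in tsupport φ, φ x * evalReal P (z - ε • x) :=
    continuous_parametric_integral_of_continuous (f := fun (ε : ℝ) (x : T l) =>
      φ x * evalReal P (z - ε • x)) (by simp only [Function.uncurry_def]; fun_prop) hφc.isCompact
  have h0 : ∫ x in tsupport φ, φ x = ∫ x, φ x :=
    setIntegral_eq_integral_of_forall_compl_eq_zero fun x hx => image_eq_zero_of_notMem_tsupport hx
  have h3 := h2.tendsto 0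
  simp only [h1, zero_smul, sub_zero, integral_mul_const, h0] at h3
  exact h3.mono_left nhdsWithin_le_nhds

/-- For small `ε` the reflected kernel around `z` is supported in `V`, so the cone measure may be
replaced by its polynomial density. The integral becomes a mollification of `𝒜 p`, which converges
to the value at `z` because `φ` has mass 1. -/
theorem HasSymbol.hasResidue {l n N : ℕ} {Λ : ConvexCone ℝ (T l)} {χ : Amb l n → ℝ}
    {φ : T l → ℂ} (hφ : Continuous φ) (hφc : HasCompactSupport φ) (hφ1 : ∫ x, φ x = 1)
    (hχφ : ∀ ζ, fourierAt χ ζ = laplace φ ζ) {β : Fin N → T l}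
    (hΛ : ∀ ξ ∈ interior (Λ : Set (T l)), ∀ j, 0 < inner ℝ (β j) ξ)
    {a : (Fin l → ℂ) → ℂ} {𝒜 : MvPolynomial (Fin l) ℂ →ₗ[ℂ] MvPolynomial (Fin l) ℂ}
    (ha : HasSymbol φ a 𝒜) {p : MvPolynomial (Fin l) ℝ} {V : Set (T l)}
    (hp : HasPolynomialDensity β p V) {z : T l} (hz : z ∈ V) :
    HasResidue Λ χ (form a β z) (1 / (2 * (π : ℂ) * Complex.I) ^ l *
      (Complex.I ^ N * (2 * (π : ℂ)) ^ l * evalReal (𝒜 (p.map Complex.ofRealHom)) z)) := by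
  intro ξ hξ
  obtain ⟨R, hR⟩ := ha.exists_kernel
  have hreg : ∀ ε : ℝ, ∀ A : T l → ℂ, (∀ ζ, laplace A ζ = a ζ * laplace φ ((ε : ℂ) • ζ)) →
      regIntegrand χ (form a β z) ξ ε = fun ψ => laplace A (shift ψ ξ) *
        Complex.exp (Complex.I * pair z (shift ψ ξ)) * (∏ j, pair (β j) (shift ψ ξ))⁻¹ := by
    intro ε A hA
    ext ψ
    rw [regIntegrand, form, hχφ, hA, div_eq_mul_inv]
    ring
  have hcs : ∀ {A : T l → ℂ} {r : ℝ}, tsupport A ⊆ Metric.closedBall 0 r → HasCompactSupport A :=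
    fun {A r} h => (isCompact_closedBall (0 : T l) r).of_isClosed_subset (isClosed_tsupport A) h
  refine ⟨fun ε hε => ?_, ?_⟩
  · obtain ⟨A, hA, hAs, hAl, -⟩ := hR ε hε
    rw [hreg ε A hAl]
    exact integrable_laplace_div (hΛ ξ hξ) hA (hcs hAs) z
  · refine Tendsto.const_mul _ ?_
    have hlim := (tendsto_mollified_evalReal hφ hφc (𝒜 (p.map Complex.ofRealHom)) z).const_mul
      (Complex.I ^ N * (2 * (π : ℂ)) ^ l)
    rw [hφ1, one_mul] at hlim
    refine hlim.congr' ?_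
    obtain ⟨r, hr, hrV⟩ := Metric.isOpen_iff.1 hp.isOpen z hz
    have hsmall : ∀ᶠ ε : ℝ in 𝓝[>] 0, R * ε < r := by
      have : Tendsto (fun ε : ℝ => R * ε) (𝓝[>] 0) (𝓝 0) := by
        have := (continuous_const_mul R).tendsto (0 : ℝ)
        rw [mul_zero] at this
        exact this.mono_left nhdsWithin_le_nhds
      exact this.eventually (gt_mem_nhds hr)
    filter_upwards [hsmall, self_mem_nhdsWithin] with ε hε hε0
    obtain ⟨A, hA, hAs, hAl, hAq⟩ := hR ε hε0
    have hAs' : tsupport (fun x => A (z - x)) ⊆ Metric.closedBall z (R * ε) := by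
      refine closure_minimal (fun x hx => ?_) Metric.isClosed_closedBall
      have := hAs (subset_tsupport _ hx)
      rwa [mem_closedBall_zero_iff, ← dist_eq_norm, dist_comm] at this
    rw [hreg ε A hAl, integral_laplace_div (hΛ ξ hξ) hA (hcs hAs),
      hp.integral_eq (fun x => A (z - x)) (hA.comp (contDiff_const.sub contDiff_id))
        ((isCompact_closedBall z (R * ε)).of_isClosed_subset (isClosed_tsupport _) hAs')
        ((hAs'.trans (Metric.closedBall_subset_ball hε)).trans hrV),
      ← hAq, ← integral_sub_left_eq_self (fun x => A x * _) _ z]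
    simp only [sub_sub_cancel, ← evalReal_map]

/-! ### The volume ratio as a value of the density. -/

theorem integral_coneMeasure {l N : ℕ} (β : Fin N → T l) {g : T l → ℂ} (hg : Continuous g) :
    ∫ x, g x ∂coneMeasure β = ∫ s in {s : Fin N → ℝ | ∀ j, 0 ≤ s j}, g (∑ j, s j • β j) :=
  integral_map (Continuous.aemeasurable (by fun_prop)) hg.aestronglyMeasurable

theorem coneMeasure_lt_top {l N : ℕ} {β : Fin N → T l} {ξ : T l}
    (hξ : ∀ j, 0 < inner ℝ (β j) ξ) {K : Set (T l)} (hK : IsCompact K) :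
    coneMeasure β K < ⊤ := by
  obtain ⟨R, hR⟩ := exists_bound_of_isCompact hξ hK
  have hB : Continuous fun s : Fin N → ℝ => ∑ j, s j • β j := by fun_prop
  rw [coneMeasure, Measure.map_apply hB.measurable hK.measurableSet,
    Measure.restrict_apply (hB.measurable hK.measurableSet)]
  refine (measure_mono ?_).trans_lt (isCompact_Icc (a := (0 : Fin N → ℝ))
    (b := fun _ => R)).measure_lt_top
  rintro s ⟨hs, hs0⟩
  exact ⟨hs0, hR s hs0 hs⟩

/-- Smooth bumps increasing to the indicator function of a ball. -/
noncomputable def ballBump {l : ℕ} (z : T l) {r : ℝ} (hr : 0 < r) (k : ℕ) : ContDiffBump z where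
  rIn := r * (1 - 1 / (k + 2))
  rOut := r
  rIn_pos := mul_pos hr (by
    rw [sub_pos, div_lt_one (by positivity)]
    have : (0 : ℝ) ≤ k := k.cast_nonneg
    linarith)
  rIn_lt_rOut := by
    have : (0 : ℝ) < 1 / (k + 2) := by positivity
    nlinarith

theorem tendsto_ballBump {l : ℕ} (z : T l) {r : ℝ} (hr : 0 < r) (x : T l) :
    Tendsto (fun k => ((ballBump z hr k x : ℝ) : ℂ)) atTop
      (𝓝 ((Metric.ball z r).indicator (fun _ => 1) x)) := by
  by_cases hx : x ∈ Metric.ball z r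
  · rw [Set.indicator_of_mem hx]
    have h1 : Tendsto (fun k : ℕ => r * (1 - 1 / ((k : ℝ) + 2))) atTop (𝓝 r) := by
      have : Tendsto (fun k : ℕ => 1 / ((k : ℝ) + 2)) atTop (𝓝 0) :=
        tendsto_const_nhds.div_atTop
          (tendsto_atTop_add_const_right _ _ tendsto_natCast_atTop_atTop)
      simpa using (this.const_sub 1).const_mul r
    refine tendsto_const_nhds.congr' ?_
    filter_upwards [h1.eventually (lt_mem_nhds (Metric.mem_ball.1 hx))] with k hk
    rw [(ballBump z hr k).one_of_mem_closedBall (Metric.mem_closedBall.2 hk.le)]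
    simp
  · rw [Set.indicator_of_notMem hx]
    refine tendsto_const_nhds.congr fun k => ?_
    rw [(ballBump z hr k).zero_of_le_dist (not_lt.1 hx)]
    simp

theorem norm_ballBump_le {l : ℕ} (z : T l) {r : ℝ} (hr : 0 < r) (k : ℕ) (x : T l) :
    ‖((ballBump z hr k x : ℝ) : ℂ)‖ ≤ (Metric.ball z r).indicator (fun _ => 1) x := by
  by_cases hx : x ∈ Metric.ball z r
  · rw [Set.indicator_of_mem hx, Complex.norm_real, Real.norm_of_nonneg (ballBump z hr k).nonneg]
    exact (ballBump z hr k).le_one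
  · rw [Set.indicator_of_notMem hx, (ballBump z hr k).zero_of_le_dist (not_lt.1 hx)]
    simp

/-- The density is known only against smooth functions; dominated convergence along bumps passes to
the ball. -/
theorem HasPolynomialDensity.coneMeasure_ball {l N : ℕ} {β : Fin N → T l} {ξ : T l}
    (hξ : ∀ j, 0 < inner ℝ (β j) ξ) {p : MvPolynomial (Fin l) ℝ} {V : Set (T l)}
    (hp : HasPolynomialDensity β p V) {z : T l} {r : ℝ} (hr : 0 < r)
    (hV : Metric.closedBall z r ⊆ V) :
    (coneMeasure β).real (Metric.ball z r) = ∫ x in Metric.ball z r, MvPolynomial.eval x p := by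
  have hball := Metric.isOpen_ball.measurableSet (α := T l) (s := Metric.ball z r)
  have hcont : ∀ k, Continuous fun x => ((ballBump z hr k x : ℝ) : ℂ) := fun k =>
    Complex.continuous_ofReal.comp (ballBump z hr k).continuous
  have hpc : Continuous fun x : T l => ((MvPolynomial.eval x p : ℝ) : ℂ) :=
    Complex.continuous_ofReal.comp (continuous_eval p)
  have heq : ∀ k, ∫ x, ((ballBump z hr k x : ℝ) : ℂ) ∂coneMeasure β =
      ∫ x, ((ballBump z hr k x : ℝ) : ℂ) * ((MvPolynomial.eval x p : ℝ) : ℂ) := fun k => by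
    have hts : tsupport (fun x => ((ballBump z hr k x : ℝ) : ℂ)) ⊆ Metric.closedBall z r := by
      refine closure_minimal (fun x hx => ?_) Metric.isClosed_closedBall
      by_contra hn
      refine hx ?_
      dsimp only
      rw [(ballBump z hr k).zero_of_le_dist (not_le.1 hn).le]
      simp
    rw [integral_coneMeasure β (hcont k)]
    exact hp.integral_eq _ (Complex.ofRealCLM.contDiff.comp (ballBump z hr k).contDiff)
      ((isCompact_closedBall z r).of_isClosed_subset (isClosed_tsupport _) hts) (hts.trans hV)
  have hfin : coneMeasure β (Metric.ball z r) ≠ ⊤ :=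
    ((measure_mono Metric.ball_subset_closedBall).trans_lt
      (coneMeasure_lt_top hξ (isCompact_closedBall z r))).ne
  have h1 := tendsto_integral_of_dominated_convergence (μ := coneMeasure β)
    (F := fun k x => ((ballBump z hr k x : ℝ) : ℂ)) ((Metric.ball z r).indicator fun _ => 1)
    (fun k => (hcont k).aestronglyMeasurable)
    ((integrable_indicator_iff hball).2 (integrableOn_const hfin))
    (fun k => .of_forall (norm_ballBump_le z hr k)) (.of_forall (tendsto_ballBump z hr))
  have h2 := tendsto_integral_of_dominated_convergence (μ := volume)
    (F := fun k x => ((ballBump z hr k x : ℝ) : ℂ) * ((MvPolynomial.eval x p : ℝ) : ℂ))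
    ((Metric.ball z r).indicator fun x => ‖((MvPolynomial.eval x p : ℝ) : ℂ)‖)
    (fun k => ((hcont k).mul hpc).aestronglyMeasurable)
    ((integrable_indicator_iff hball).2 ((hpc.norm.continuousOn.integrableOn_compact
      (isCompact_closedBall z r)).mono_set Metric.ball_subset_closedBall))
    (fun k => .of_forall fun x => by
      rw [norm_mul]
      refine (mul_le_mul_of_nonneg_right (norm_ballBump_le z hr k x) (norm_nonneg _)).trans_eq ?_
      by_cases hx : x ∈ Metric.ball z r <;> simp [hx])
    (.of_forall fun x => (tendsto_ballBump z hr x).mul_const _)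
  simp only [heq] at h1
  have h3 := tendsto_nhds_unique h1 h2
  rw [integral_indicator hball, setIntegral_const] at h3
  have h4 : ∀ x, (Metric.ball z r).indicator (fun _ => (1 : ℂ)) x *
      ((MvPolynomial.eval x p : ℝ) : ℂ) =
      (Metric.ball z r).indicator (fun x : T l => ((MvPolynomial.eval x p : ℝ) : ℂ)) x := fun x => by
    by_cases hx : x ∈ Metric.ball z r <;> simp [hx]
  simp only [h4] at h3
  rw [integral_indicator hball, integral_complex_ofReal, Complex.real_smul, mul_one] at h3
  exact_mod_cast h3

theorem HasPolynomialDensity.tendsto_volRatio {l N : ℕ} {β : Fin N → T l} {ξ : T l}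
    (hξ : ∀ j, 0 < inner ℝ (β j) ξ) {p : MvPolynomial (Fin l) ℝ} {V : Set (T l)}
    (hp : HasPolynomialDensity β p V) {z : T l} (hz : z ∈ V) :
    Tendsto (volRatio β z) (𝓝[>] 0) (𝓝 (MvPolynomial.eval z p)) := by
  obtain ⟨δ₁, hδ₁, hV⟩ := Metric.isOpen_iff.1 hp.isOpen z hz
  rw [Metric.tendsto_nhds]
  intro ε hε
  obtain ⟨δ₂, hδ₂, hc⟩ := Metric.continuousAt_iff.1 (continuous_eval p).continuousAt (ε / 2)
    (half_pos hε)
  filter_upwards [Ioo_mem_nhdsGT (lt_min hδ₁ hδ₂)] with r hr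
  have hv : 0 < (volume : Measure (T l)).real (Metric.ball z r) :=
    ENNReal.toReal_pos (Metric.measure_ball_pos _ z hr.1).ne' measure_ball_lt_top.ne
  have hint : IntegrableOn (fun x : T l => MvPolynomial.eval x p) (Metric.ball z r) :=
    ((continuous_eval p).continuousOn.integrableOn_compact
      (isCompact_closedBall z r)).mono_set Metric.ball_subset_closedBall
  have h1 : ‖∫ x in Metric.ball z r, (MvPolynomial.eval x p - MvPolynomial.eval z p)‖ ≤
      ε / 2 * (volume : Measure (T l)).real (Metric.ball z r) :=
    norm_setIntegral_le_of_norm_le_const measure_ball_lt_top fun x hx =>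
      (hc ((Metric.mem_ball.1 hx).trans (hr.2.trans_le (min_le_right _ _)))).le
  rw [integral_sub hint (integrableOn_const measure_ball_lt_top.ne), setIntegral_const,
    ← hp.coneMeasure_ball hξ hr.1 ((Metric.closedBall_subset_ball
      (hr.2.trans_le (min_le_left _ _))).trans hV)] at h1
  rw [volRatio, Real.dist_eq, div_sub' hv.ne', abs_div, abs_of_pos hv, div_lt_iff₀ hv]
  rw [Real.norm_eq_abs, smul_eq_mul] at h1
  exact h1.trans_lt (mul_lt_mul_of_pos_right (half_lt_self hε) hv)

/-! ### Homogeneity, Taylor expansion at the origin, and multi-indices. -/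

theorem evalReal_smul {l : ℕ} {P : MvPolynomial (Fin l) ℂ} {e : ℕ} (hP : P.IsHomogeneous e)
    (s : ℝ) (x : T l) : evalReal P (s • x) = (s : ℂ) ^ e * evalReal P x := by
  simp only [evalReal, MvPolynomial.eval_eq', Finset.mul_sum]
  refine Finset.sum_congr rfl fun d hd => ?_
  have : ∑ k, d k = e := by
    rw [← Finsupp.degree_eq_sum, Finsupp.degree_eq_weight_one]
    exact hP (MvPolynomial.mem_support_iff.1 hd)
  simp only [PiLp.smul_apply, smul_eq_mul, Complex.ofReal_mul, mul_pow, Finset.prod_mul_distrib,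
    Finset.prod_pow_eq_pow_sum, this]
  ring

theorem dirDeriv_eq_sum {l : ℕ} (y : T l) (P : MvPolynomial (Fin l) ℂ) :
    dirDeriv y P = ∑ k, MvPolynomial.C (y k : ℂ) * MvPolynomial.pderiv k P := by
  induction P using MvPolynomial.induction_on with
  | C a => simp [MvPolynomial.derivation_C]
  | add p q hp hq => simp [hp, hq, mul_add, Finset.sum_add_distrib]
  | mul_X p i hp =>
    have hX : dirDeriv y (MvPolynomial.X i) = MvPolynomial.C (y i : ℂ) :=
      MvPolynomial.mkDerivation_X _ _ _
    simp only [Derivation.leibniz, smul_eq_mul, hX, hp, MvPolynomial.pderiv_X, mul_add,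
      Finset.sum_add_distrib, Finset.mul_sum]
    congr 1
    · rw [Finset.sum_eq_single i] <;> simp +contextual [mul_comm]
    · exact Finset.sum_congr rfl fun k _ => by ring

theorem IsHomogeneousInt.dirDeriv {l : ℕ} {P : MvPolynomial (Fin l) ℂ} {d : ℤ}
    (hP : IsHomogeneousInt P d) (y : T l) : IsHomogeneousInt (dirDeriv y P) (d - 1) := by
  rcases hP with rfl | ⟨e, rfl, hP⟩
  · left; simp
  rcases Nat.eq_zero_or_pos e with rfl | he
  · left
    rw [← MvPolynomial.totalDegree_zero_iff_isHomogeneous,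
      MvPolynomial.totalDegree_eq_zero_iff_eq_C] at hP
    rw [hP, MvPolynomial.derivation_C]
  · refine .inr ⟨e - 1, by omega, ?_⟩
    rw [dirDeriv_eq_sum]
    exact MvPolynomial.IsHomogeneous.sum _ _ _ fun k _ => hP.pderiv.C_mul _

theorem evalReal_dirDeriv_self {l : ℕ} {P : MvPolynomial (Fin l) ℂ} {e : ℕ}
    (hP : P.IsHomogeneous e) (y : T l) : evalReal (dirDeriv y P) y = e * evalReal P y := by
  have := congrArg (MvPolynomial.eval fun k => (y k : ℂ)) hP.sum_X_mul_pderiv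
  simpa [evalReal, dirDeriv_eq_sum] using this

theorem evalReal_iterate_dirDeriv {l : ℕ} {P : MvPolynomial (Fin l) ℂ} {e : ℕ}
    (hP : P.IsHomogeneous e) (y : T l) :
    evalReal ((dirDeriv y)^[e] P) y = e.factorial * evalReal P y := by
  induction e generalizing P with
  | zero => simp
  | succ e ih =>
    rw [Function.iterate_succ_apply]
    have h1 : (dirDeriv y P).IsHomogeneous e := by
      rw [dirDeriv_eq_sum]
      exact MvPolynomial.IsHomogeneous.sum _ _ _ fun k _ => hP.pderiv.C_mul _
    rw [ih h1, evalReal_dirDeriv_self hP, Nat.factorial_succ]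
    push_cast
    ring

/-- The Taylor expansion at `0` of a homogeneous polynomial has a single term. -/
theorem hasSum_iterate_dirDeriv {l : ℕ} {P : MvPolynomial (Fin l) ℂ} {d : ℤ}
    (hP : IsHomogeneousInt P d) (y : T l) :
    HasSum (fun m : ℕ => 1 / (m.factorial : ℂ) * evalReal ((dirDeriv y)^[m] P) 0)
      (evalReal P y) := by
  have hit : ∀ m : ℕ, IsHomogeneousInt ((dirDeriv y)^[m] P) (d - m) := fun m => by
    induction m with
    | zero => simpa using hP
    | succ m ih =>
      rw [Function.iterate_succ_apply']
      convert ih.dirDeriv y using 1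
      push_cast; ring
  rcases hP with rfl | ⟨e, rfl, hP⟩
  · have : ∀ m : ℕ, (dirDeriv y)^[m] (0 : MvPolynomial (Fin l) ℂ) = 0 := fun m =>
      Function.iterate_fixed (map_zero _) m
    simp [this, evalReal]
  -- Evaluation at `0` is scaling by `0`, so only degree `i = 0` survives, with `0 ^ 0 = 1`.
  have h0 : ∀ m i : ℕ, ((dirDeriv y)^[m] P).IsHomogeneous i →
      evalReal ((dirDeriv y)^[m] P) 0 = (0 : ℂ) ^ i * evalReal ((dirDeriv y)^[m] P) y :=
    fun m i h => by simpa using evalReal_smul h 0 y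
  have he : 1 / (e.factorial : ℂ) * evalReal ((dirDeriv y)^[e] P) 0 = evalReal P y := by
    have h2 : (e.factorial : ℂ) ≠ 0 := by exact_mod_cast e.factorial_ne_zero
    have h3 := evalReal_iterate_dirDeriv hP y
    rcases hit e with h | ⟨i, hi, h⟩
    · rw [h] at h3 ⊢
      simp only [evalReal, map_zero, zero_eq_mul, h2, false_or] at h3
      simp [evalReal, h3]
    · obtain rfl : i = 0 := by omega
      rw [h0 e 0 h, h3]
      field_simp
  rw [← he]
  refine hasSum_single e fun m hm => ?_
  rcases hit m with h | ⟨i, hi, h⟩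
  · simp [h, evalReal]
  · rw [h0 m i h, zero_pow (by omega)]
    simp

theorem mono_add_single {l : ℕ} (J : Fin l → ℕ) (k : Fin l) (ζ : Fin l → ℂ) :
    mono (J + Pi.single k 1) ζ = ζ k * mono J ζ := by
  simp only [mono, Pi.add_apply, pow_add, Finset.prod_mul_distrib]
  rw [mul_comm, Finset.prod_eq_single k] <;> simp +contextual

theorem sum_add_single {l : ℕ} (J : Fin l → ℕ) (k : Fin l) :
    ∑ i, (J + Pi.single k 1 : Fin l → ℕ) i = ∑ i, J i + 1 := by
  simp only [Pi.add_apply, Finset.sum_add_distrib]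
  simp

theorem multiIndex_induction {l : ℕ} {C : (Fin l → ℕ) → Prop} (h0 : C 0)
    (hs : ∀ J k, C J → C (J + Pi.single k 1)) (J : Fin l → ℕ) : C J := by
  induction h : ∑ k, J k generalizing J with
  | zero =>
    have : J = 0 := by
      ext k
      exact (Finset.sum_eq_zero_iff.1 h) k (Finset.mem_univ k)
    exact this ▸ h0
  | succ m ih =>
    obtain ⟨k, -, hk⟩ := Finset.exists_ne_zero_of_sum_ne_zero (by omega : ∑ k, J k ≠ 0)
    have hle : Pi.single k 1 ≤ J := by
      intro i
      by_cases hi : i = k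
      · subst hi; simp; omega
      · simp [hi]
    have hJ : J = (J - Pi.single k 1) + Pi.single k 1 := (tsub_add_cancel_of_le hle).symm
    rw [hJ]
    refine hs _ k (ih _ ?_)
    have := sum_add_single (J - Pi.single k 1) k
    rw [← hJ] at this
    omega

theorem pair_single {l : ℕ} (k : Fin l) (ζ : Fin l → ℂ) :
    pair (EuclideanSpace.single k 1) ζ = ζ k := by
  simp [pair, apply_ite ((↑) : ℝ → ℂ), ite_mul]

theorem exists_hasSymbol_mono {l : ℕ} {φ : T l → ℂ} (hφ : ContDiff ℝ ∞ φ)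
    (hφc : HasCompactSupport φ) (J : Fin l → ℕ) :
    ∃ 𝒜, HasSymbol φ (mono J) 𝒜 ∧ ∀ P (d : ℤ), IsHomogeneousInt P d →
      IsHomogeneousInt (𝒜 P) (d - (∑ k, J k : ℕ)) := by
  induction J using multiIndex_induction with
  | h0 =>
    refine ⟨LinearMap.id, ?_, fun P d h => by simpa using h⟩
    convert! HasSymbol.one hφ hφc using 1
    ext ζ
    simp [mono]
  | hs J k ih =>
    obtain ⟨𝒜, h1, h2⟩ := ih
    have h3 := h1.pair_mul (EuclideanSpace.single k 1)
    refine ⟨-Complex.I • (dirDeriv (EuclideanSpace.single k 1) :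
      _ →ₗ[ℂ] MvPolynomial (Fin l) ℂ) ∘ₗ 𝒜, ?_, fun P d h => ?_⟩
    · convert! h3 using 1
      ext ζ
      rw [mono_add_single, pair_single]
    · have := ((h2 P d h).dirDeriv (EuclideanSpace.single k 1)).C_mul (-Complex.I)
      rw [← MvPolynomial.smul_eq_C_mul] at this
      rw [sum_add_single]
      convert! this using 1
      push_cast
      ring

/-- The symbol of `y(ζ)` is `-i ∂_y`, so each factor `i y(ζ)` acts as `∂_y` itself. -/
theorem HasSymbol.pow_mul {l : ℕ} {φ : T l → ℂ} {a : (Fin l → ℂ) → ℂ}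
    {𝒜 : MvPolynomial (Fin l) ℂ →ₗ[ℂ] MvPolynomial (Fin l) ℂ} (h : HasSymbol φ a 𝒜) (y : T l)
    (m : ℕ) : ∃ ℬ, HasSymbol φ (fun ζ => (Complex.I * pair y ζ) ^ m * a ζ) ℬ ∧
      ∀ P, ℬ P = (dirDeriv y)^[m] (𝒜 P) := by
  induction m with
  | zero => exact ⟨𝒜, by simpa using h, fun P => rfl⟩
  | succ m ih =>
    obtain ⟨ℬ, h1, h2⟩ := ih
    refine ⟨Complex.I • (-Complex.I • (dirDeriv y : _ →ₗ[ℂ] MvPolynomial (Fin l) ℂ) ∘ₗ ℬ), ?_,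
      fun P => ?_⟩
    · convert! (h1.pair_mul y).const_mul Complex.I using 1
      ext ζ
      ring
    · rw [Function.iterate_succ_apply', ← h2]
      simp [smul_smul]

/-! ### Uniqueness of the residue and the proof of the proposition. -/

/-- Nonemptiness of the interior is essential: otherwise every `r` would be a residue vacuously. -/
theorem res_eq {l n : ℕ} {Λ : ConvexCone ℝ (T l)} (hΛ : (interior (Λ : Set (T l))).Nonempty)
    {χ : Amb l n → ℝ} {h : (Fin l → ℂ) → ℂ} {r : ℂ} (hr : HasResidue Λ χ h r) :
    res Λ χ h = r := by
  obtain ⟨ξ, hξ⟩ := hΛ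
  have h1 : HasResidue Λ χ h (res Λ χ h) := Classical.epsilon_spec ⟨r, hr⟩
  exact tendsto_nhds_unique (h1 ξ hξ).2 (hr ξ hξ).2

/-- From an interior point one can move a little along `-b` inside `Λ`, which strictly decreases the
functional. -/
theorem inner_pos_of_mem_interior {l : ℕ} {Λ : ConvexCone ℝ (T l)} {b : T l} (hb : b ≠ 0)
    (hdual : ∀ x ∈ Λ, 0 ≤ inner ℝ b x) {ξ : T l} (hξ : ξ ∈ interior (Λ : Set (T l))) :
    0 < inner ℝ b ξ := by
  have h1 : Tendsto (fun t : ℝ => ξ - t • b) (𝓝[>] 0) (𝓝 ξ) := by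
    have : Continuous fun t : ℝ => ξ - t • b := by fun_prop
    have := this.tendsto 0
    simp only [zero_smul, sub_zero] at this
    exact this.mono_left nhdsWithin_le_nhds
  obtain ⟨t, ht, ht0⟩ := ((h1.eventually (mem_interior_iff_mem_nhds.1 hξ)).and
    self_mem_nhdsWithin).exists
  have h2 := hdual _ ht
  rw [inner_sub_right, inner_smul_right] at h2
  have h3 : 0 < t * inner ℝ b b := mul_pos ht0 (real_inner_self_pos.2 hb)
  linarith

end JKResidue

open JKResidue in
theorem proposition8p11 {l n N : ℕ} (Λ : ConvexCone ℝ (T l))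
    (hΛ : (interior (Λ : Set (T l))).Nonempty)
    (χ : Amb l n → ℝ) (hχ : IsTestFunction χ)
    (β : Fin N → T l) (hβ : ∀ j, β j ≠ 0)
    (hdual : ∀ j, ∀ x ∈ Λ, 0 ≤ inner ℝ (β j) x) :
    -- the residues exist, and agree with their limits along any ray `y + t ρ`
    (∀ J : Fin l → ℕ, ∀ y ∈ genericSet β,
      HasResidue Λ χ (form (mono J) β y) (res Λ χ (form (mono J) β y)) ∧
      ∀ ρ : T l, Tendsto (fun t : ℝ => res Λ χ (form (mono J) β (y + t • ρ))) (𝓝[>] 0)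
        (𝓝 (res Λ χ (form (mono J) β y)))) ∧
    -- (i)
    (∀ J : Fin l → ℕ, ∀ k : Fin l, ∀ y ∈ genericSet β,
      LineDifferentiableAt ℝ (fun μ => res Λ χ (form (mono J) β μ)) y
        (EuclideanSpace.single k 1) ∧
      res Λ χ (form (fun ζ => ζ k * mono J ζ) β y) =
        -Complex.I * lineDeriv ℝ (fun μ => res Λ χ (form (mono J) β μ)) y
          (EuclideanSpace.single k 1)) ∧
    -- (ii)
    (∀ y ∈ genericSet β,
      Tendsto (volRatio β y) (𝓝[>] 0) (𝓝 (H β y)) ∧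
      (2 * (π : ℂ) * Complex.I) ^ l * res Λ χ (form (fun _ => 1) β y) =
        (2 * (π : ℂ)) ^ l * Complex.I ^ N * (H β y : ℂ)) ∧
    -- (iii)
    (∀ y ∈ genericSet β, y ∉ cone β Finset.univ → res Λ χ (form (fun _ => 1) β y) = 0) ∧
    -- (iv)
    (∀ J : Fin l → ℕ, ∀ y ∈ genericSet β, N ≠ (∑ k, J k) + l →
      Tendsto (fun s : ℝ => res Λ χ (form (mono J) β (s • y))) (𝓝[>] 0) (𝓝 0)) ∧
    -- (v)
    (∀ J : Fin l → ℕ, ∀ y ∈ genericSet β, Submodule.span ℝ (Set.range β) ≠ ⊤ →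
      Tendsto (fun s : ℝ => res Λ χ (form (mono J) β (s • y))) (𝓝[>] 0) (𝓝 0)) ∧
    -- (vi)
    (∀ (f : Fin l ↪ Fin N) (c : Fin l → ℝ) (b : OrthonormalBasis (Fin l) ℝ (T l)),
      Submodule.span ℝ (Set.range (β ∘ f)) = ⊤ → (∀ j, 0 < c j) →
      Tendsto (fun s : ℝ => res Λ χ (form (fun _ => 1) (β ∘ f) (s • ∑ j, c j • β (f j))))
        (𝓝[>] 0) (𝓝 ((1 / |(b.toBasis.toMatrix (β ∘ f)).det| : ℝ) : ℂ))) ∧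
    -- (vii)
    (∀ J : Fin l → ℕ, ∀ y ∈ genericSet β,
      ∃ a : ℕ → ℂ,
        (∀ m : ℕ,
          (∀ s : ℝ, 0 < s → ∃ r : ℂ, HasResidue Λ χ
            (form (fun ζ => (Complex.I * pair y ζ) ^ m * mono J ζ / (m.factorial : ℂ)) β (s • y))
            r) ∧
          Tendsto (fun s : ℝ => res Λ χ
            (form (fun ζ => (Complex.I * pair y ζ) ^ m * mono J ζ / (m.factorial : ℂ)) β (s • y)))
            (𝓝[>] 0) (𝓝 (a m))) ∧
        HasSum a (res Λ χ (form (mono J) β y))) ∧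
    -- the residues are the only functions on `genericSet β` that satisfy (i) and (ii)
    (∀ R : (Fin l → ℕ) → T l → ℂ,
      (∀ y ∈ genericSet β, (2 * (π : ℂ) * Complex.I) ^ l * R 0 y =
        (2 * (π : ℂ)) ^ l * Complex.I ^ N * (H β y : ℂ)) →
      (∀ (J : Fin l → ℕ) (k : Fin l), ∀ y ∈ genericSet β,
        R (J + Pi.single k 1) y =
          -Complex.I * lineDeriv ℝ (R J) y (EuclideanSpace.single k 1)) →
      ∀ J : Fin l → ℕ, ∀ y ∈ genericSet β, R J y = res Λ χ (form (mono J) β y)) := by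
  have hpos : ∀ ξ ∈ interior (Λ : Set (T l)), ∀ j, 0 < inner ℝ (β j) ξ := fun ξ hξ j =>
    inner_pos_of_mem_interior (hβ j) (hdual j) hξ
  obtain ⟨ξ₀, hξ₀⟩ := id hΛ
  have hβξ := hpos ξ₀ hξ₀
  obtain ⟨φ, hφ, hφc, hχφ⟩ := exists_marginal hχ.smooth hχ.compact
  have hφ1 : ∫ x, φ x = 1 := by
    have := hχ.normalized
    rw [hχφ, laplace] at this
    simpa [pair] using this
  choose 𝒜 h𝒜 hdeg using exists_hasSymbol_mono hφ hφc
  set κ : ℂ := 1 / (2 * (π : ℂ) * Complex.I) ^ l * (Complex.I ^ N * (2 * (π : ℂ)) ^ l) with hκ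
  have hpi : (2 * (π : ℂ) * Complex.I) ^ l ≠ 0 :=
    pow_ne_zero _ (mul_ne_zero (mul_ne_zero two_ne_zero (by exact_mod_cast Real.pi_ne_zero))
      Complex.I_ne_zero)
  have hhas : ∀ {p V}, HasPolynomialDensity β p V → ∀ {a ℬ}, HasSymbol φ a ℬ → ∀ {z}, z ∈ V →
      HasResidue Λ χ (form a β z) (κ * evalReal (ℬ (p.map Complex.ofRealHom)) z) :=
    fun hp _ _ ha z hz => by
      rw [hκ, mul_assoc]
      exact ha.hasResidue hφ.continuous hφc hφ1 hχφ hpos hp hz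
  have hres : ∀ {p V}, HasPolynomialDensity β p V → ∀ {a ℬ}, HasSymbol φ a ℬ → ∀ {z}, z ∈ V →
      res Λ χ (form a β z) = κ * evalReal (ℬ (p.map Complex.ofRealHom)) z :=
    fun hp _ _ ha z hz => res_eq hΛ (hhas hp ha hz)
  have hcont : ∀ (P : MvPolynomial (Fin l) ℂ) (v w : T l),
      Tendsto (fun t : ℝ => κ * evalReal P (v + t • w)) (𝓝[>] 0) (𝓝 (κ * evalReal P v)) := by
    intro P v w
    have hP := (contDiff_evalReal P).continuous
    have : Continuous fun t : ℝ => κ * evalReal P (v + t • w) := by fun_prop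
    have := this.tendsto 0
    simp only [zero_smul, add_zero] at this
    exact this.mono_left nhdsWithin_le_nhds
  have hline : ∀ J, ∀ k : Fin l, ∀ {p V}, HasPolynomialDensity β p V → ∀ {y}, y ∈ V →
      HasLineDerivAt ℝ (fun μ => res Λ χ (form (mono J) β μ))
        (κ * evalReal (dirDeriv (EuclideanSpace.single k 1) (𝒜 J (p.map Complex.ofRealHom))) y) y
        (EuclideanSpace.single k 1) := by
    intro J k p V hp y hy
    have h1 : HasLineDerivAt ℝ (fun μ => κ * evalReal (𝒜 J (p.map Complex.ofRealHom)) μ)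
        (κ * evalReal (dirDeriv (EuclideanSpace.single k 1) (𝒜 J (p.map Complex.ofRealHom))) y) y
        (EuclideanSpace.single k 1) := (hasLineDerivAt_evalReal _ _ _).const_mul κ
    refine h1.congr_of_eventuallyEq ?_
    filter_upwards [hp.isOpen.mem_nhds hy] with z hz
    exact hres hp (h𝒜 J) hz
  have hone : ∀ {p V}, HasPolynomialDensity β p V → ∀ {z}, z ∈ V →
      res Λ χ (form (fun _ => 1) β z) = κ * ((MvPolynomial.eval z p : ℝ) : ℂ) :=
    fun hp z hz => by
      rw [hres hp (HasSymbol.one hφ hφc) hz, LinearMap.id_apply, evalReal_map]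
  have hden : ∀ y ∈ genericSet β, ∃ p V, y ∈ V ∧ HasPolynomialDensity β p V ∧
      IsHomogeneousInt p ((N : ℤ) - l) := fun y hy => exists_hasPolynomialDensity hβξ hy
  have hhom : ∀ {p : MvPolynomial (Fin l) ℝ} {d : ℤ}, IsHomogeneousInt p d → ∀ J,
      IsHomogeneousInt (𝒜 J (p.map Complex.ofRealHom)) (d - (∑ k, J k : ℕ)) := fun {p d} hp J =>
    hdeg J _ _ (hp.elim (fun h => .inl (by rw [h, map_zero]))
      fun ⟨e, he, h⟩ => .inr ⟨e, he, h.map _⟩)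
  -- The ray `s • y` stays in the cone `V`, so the limit is the value at `0` of one polynomial, of
  -- degree `d - |J| ≠ 0`.
  have hlim : ∀ J, ∀ y ∈ genericSet β, ∀ {p V} {d : ℤ}, HasPolynomialDensity β p V → y ∈ V →
      IsHomogeneousInt p d → d ≠ (∑ k, J k : ℕ) →
      Tendsto (fun s : ℝ => res Λ χ (form (mono J) β (s • y))) (𝓝[>] 0) (𝓝 0) := by
    intro J y hy p V d hp hyV hpd hd
    have h1 := hcont (𝒜 J (p.map Complex.ofRealHom)) 0 y
    have h2 : evalReal (𝒜 J (p.map Complex.ofRealHom)) 0 = 0 := by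
      rcases hhom hpd J with h | ⟨e, he, h⟩
      · rw [h, evalReal, map_zero]
      · have h3 := evalReal_smul h 0 0
        rw [zero_smul] at h3
        rw [h3, Complex.ofReal_zero, zero_pow (by omega), zero_mul]
    simp only [h2, mul_zero, zero_add] at h1
    refine h1.congr' ?_
    filter_upwards [self_mem_nhdsWithin] with s hs
    exact (hres hp (h𝒜 J) (hp.smul_mem s hs y hyV)).symm
  have hcompl : ∀ y ∈ genericSet β, y ∉ cone β Finset.univ →
      HasPolynomialDensity β 0 (cone β Finset.univ)ᶜ := fun y _ _ =>
    hasPolynomialDensity_compl_cone hβξ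
  have hvol : ∀ y ∈ genericSet β, Tendsto (volRatio β y) (𝓝[>] 0) (𝓝 (H β y)) ∧
      (2 * (π : ℂ) * Complex.I) ^ l * res Λ χ (form (fun _ => 1) β y) =
        (2 * (π : ℂ)) ^ l * Complex.I ^ N * (H β y : ℂ) := by
    intro y hy
    obtain ⟨p, V, hyV, hp, -⟩ := hden y hy
    have h1 := hp.tendsto_volRatio hβξ hyV
    have h2 : H β y = MvPolynomial.eval y p := h1.limUnder_eq
    refine ⟨h2 ▸ h1, ?_⟩
    rw [hone hp hyV, h2, hκ]
    field_simp
  have hmono0 : mono (0 : Fin l → ℕ) = fun _ => 1 := by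
    ext ζ
    simp [mono]
  have hderiv : ∀ J : Fin l → ℕ, ∀ k : Fin l, ∀ y ∈ genericSet β,
      res Λ χ (form (fun ζ => ζ k * mono J ζ) β y) =
        -Complex.I * lineDeriv ℝ (fun μ => res Λ χ (form (mono J) β μ)) y
          (EuclideanSpace.single k 1) := by
    intro J k y hy
    obtain ⟨p, V, hyV, hp, -⟩ := hden y hy
    have h1 := (h𝒜 J).pair_mul (EuclideanSpace.single k 1)
    simp only [pair_single] at h1
    rw [(hline J k hp hyV).lineDeriv, hres hp h1 hyV]
    simp only [evalReal, LinearMap.smul_apply, LinearMap.comp_apply, MvPolynomial.smul_eval,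
      Derivation.coeFn_coe]
    ring
  refine ⟨fun J y hy => ?_, fun J k y hy => ⟨?_, hderiv J k y hy⟩, hvol, fun y hy hyc => ?_,
    fun J y hy hN => ?_, fun J y hy hspan => ?_, fun f c b hspan hc => ?_, fun J y hy => ?_,
    fun R hR0 hR J => ?_⟩
  · obtain ⟨p, V, hyV, hp, -⟩ := hden y hy
    rw [hres hp (h𝒜 J) hyV]
    refine ⟨hhas hp (h𝒜 J) hyV, fun ρ => (hcont _ y ρ).congr' ?_⟩
    have h1 : Tendsto (fun t : ℝ => y + t • ρ) (𝓝[>] 0) (𝓝 y) := by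
      have : Continuous fun t : ℝ => y + t • ρ := by fun_prop
      have := this.tendsto 0
      simp only [zero_smul, add_zero] at this
      exact this.mono_left nhdsWithin_le_nhds
    filter_upwards [h1.eventually (hp.isOpen.mem_nhds hyV)] with t ht
    exact (hres hp (h𝒜 J) ht).symm
  · obtain ⟨p, V, hyV, hp, -⟩ := hden y hy
    exact (hline J k hp hyV).lineDifferentiableAt
  · rw [hone (hcompl y hy hyc) hyc]
    simp
  · obtain ⟨p, V, hyV, hp, hd⟩ := hden y hy
    exact hlim J y hy hp hyV hd (by omega)
  · have hyc : y ∉ cone β Finset.univ := fun h => hspan (span_eq_top_of_mem_cone hy h)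
    -- The zero density counts as homogeneous of every degree, and `-1` is never equal to `|J|`.
    exact hlim J y hy (d := -1) (hcompl y hy hyc) hyc (.inl rfl) (by omega)
  · have hli : LinearIndependent ℝ (β ∘ f) :=
      linearIndependent_of_top_le_span_of_card_eq_finrank hspan.ge (by simp)
    obtain ⟨V, hV, hp⟩ := hasPolynomialDensity_basis hli hc b
    refine tendsto_const_nhds.congr' ?_
    filter_upwards [self_mem_nhdsWithin] with s hs
    have h1 := res_eq hΛ ((HasSymbol.one hφ hφc).hasResidue hφ.continuous hφc hφ1 hχφ
      (fun ξ hξ j => hpos ξ hξ (f j)) hp (hp.smul_mem s hs _ hV))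
    simp only [Function.comp_apply] at h1
    rw [LinearMap.id_apply, evalReal_map, MvPolynomial.eval_C] at h1
    refine Eq.trans ?_ h1.symm
    -- With exactly `l` weights the prefactor `i^l (2π)^l / (2πi)^l` is `1`.
    rw [mul_pow] at hpi ⊢
    field_simp
  · obtain ⟨p, V, hyV, hp, hd⟩ := hden y hy
    choose ℬ hℬ hℬ' using (h𝒜 J).pow_mul y
    have hsym : ∀ m : ℕ, HasSymbol φ
        (fun ζ => (Complex.I * pair y ζ) ^ m * mono J ζ / (m.factorial : ℂ))
        ((1 / (m.factorial : ℂ)) • ℬ m) := fun m => by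
      convert! (hℬ m).const_mul (1 / (m.factorial : ℂ)) using 2
      ring
    -- The terms are `κ ∂_y^m (𝒜 J p)(0) / m!`, the Taylor terms at `0` of the residue in the
    -- direction `y`.
    refine ⟨fun m => κ * evalReal (((1 / (m.factorial : ℂ)) • ℬ m) (p.map Complex.ofRealHom)) 0,
      fun m => ⟨fun s hs => ⟨_, hhas hp (hsym m) (hp.smul_mem s hs y hyV)⟩, ?_⟩, ?_⟩
    · have h1 := hcont (((1 / (m.factorial : ℂ)) • ℬ m) (p.map Complex.ofRealHom)) 0 y
      simp only [zero_add] at h1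
      refine h1.congr' ?_
      filter_upwards [self_mem_nhdsWithin] with s hs
      exact (hres hp (hsym m) (hp.smul_mem s hs y hyV)).symm
    · rw [hres hp (h𝒜 J) hyV]
      refine HasSum.mul_left κ ?_
      convert! hasSum_iterate_dirDeriv (hhom hd J) y using 2 with m
      simp only [evalReal, LinearMap.smul_apply, MvPolynomial.smul_eval, hℬ']
  · induction J using multiIndex_induction with
    | h0 =>
      intro y hy
      rw [hmono0]
      exact mul_left_cancel₀ hpi ((hR0 y hy).trans (hvol y hy).2.symm)
    | hs J k ih =>
      intro y hy
      have h1 : R J =ᶠ[𝓝 y] fun μ => res Λ χ (form (mono J) β μ) := by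
        filter_upwards [(isOpen_genericSet hβξ).mem_nhds hy] with z hz
        exact ih z hz
      have h2 : mono (J + Pi.single k 1) = fun ζ => ζ k * mono J ζ :=
        funext (mono_add_single J k)
      rw [hR J k y hy, h2, hderiv J k y hy, h1.lineDeriv_eq]
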